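/- For $x>0$ and complex $r,s,t$ with $\Re(r+t)>1$, $\Re(s+t)>1$, $\Re(r+s+t)>2$, let $$\Theta(r,s,t,x)=\sum_{n=1}^{\infty}\sum_{m=1}^{\infty}\frac{1}{n^{r}m^{s}(n+mx)^{t}},$$ an absolutely convergent double series. For fixed $r,s,x$, the same symbol denotes the meromorphic continuation in $t$ to $\mathbb{C}$. Let $\zeta$ be the Riemann zeta function, $\gamma$ Euler's constant, $H_n=\sum_{j=1}^n 1/j$ (so $H_0=0$), and $\psi=\Gamma'/\Gamma$. **Theorem.** Let $r\ge 1$ and $\ell\ge 0$ be integers and let $x>0$. Then for every $s\in\mathbb{C}$ the meromorphic continuation of $\Theta(r,s,t,x)$ in $t$ to $\mathbb{C}$ exists. Put $$\varepsilon=t-(1-r-\ell),\qquad N=r+\ell-1 .$$ As $t\to 1-r-\ell$ (with $t\neq 1-r-\ell$), the following expansions hold. **Case I.** If $s\in\mathbb{Z}$ with $s>r+\ell$, or $s\in\mathbb{C}\setminus\mathbb{Z}$, then $$\Theta(r,s,t,x)=\binom{N}{\ell}x^{\ell}\frac{\zeta(s-\ell)}{\varepsilon}+\binom{N}{\ell}x^{\ell}\zeta(s-\ell)\left(\gamma+H_{r-1}-H_{N}\right)+\sum_{\substack{k=0\\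 k\ne r-1}}^{N}\binom{N}{k}x^{N-k}\zeta(r-k)\zeta(1+k-\ell-r+s)+O(|\varepsilon|).$$ **Case II.** If $s\in\mathbb{Z}$ with $s\le 0$, then $$\Theta(r,s,t,x)=\binom{N}{\ell}x^{\ell}\frac{\zeta(s-\ell)}{\varepsilon}+\binom{N}{\ell}x^{\ell}\zeta(s-\ell)\left(\gamma+H_{r-1}-H_{N}\right)+\sum_{\substack{k=0\\ k\ne r-1}}^{N}\binom{N}{k}x^{N-k}\zeta(r-k)\zeta(1+k-\ell-r+s)+(-1)^{s-1}\frac{N!\,(-s)!}{(r+\ell-s)!}x^{s-1}\zeta(s-\ell)+O(|\varepsilon|).$$ **Case III.** If $s$ is an integer with $1\le s\le r+\ell$ and $s\ne \ell+1$, then $$\begin{aligned}\Theta(r,s,t,x)={}&\binom{N}{\ell}x^{\ell}\frac{\zeta(s-\ell)}{\varepsilon}+\binom{N}{\ell}x^{\ell}\zeta(s-\ell)\left(\gamma+H_{r-1}-H_{N}\right)\\&+\binom{N}{s-1}x^{s-1}\frac{\zeta(s-\ell)}{\varepsilon}+\binom{N}{s-1}x^{s-1}\zeta(s-\ell)\left(\gamma+H_{s-1}-H_{N}-\log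 x\right)\\&+\sum_{\substack{k=0\\ k\ne r-1,\;k\ne r+\ell-s}}^{N}\binom{N}{k}x^{N-k}\zeta(r-k)\zeta(1+k-\ell-r+s)+O(|\varepsilon|).\end{aligned}$$ **Case IV.** If $s=\ell+1$, then $$\begin{aligned}\Theta(r,s,t,x)={}&\binom{N}{\ell}\frac{2x^{\ell}}{\varepsilon^2}+\binom{N}{\ell}\frac{x^{\ell}\left(2\gamma+H_{\ell}+H_{r-1}-2H_{N}-\log x\right)}{\varepsilon}\\&+\frac13\binom{N}{\ell}x^{\ell}\Big(-\pi^2+3(\gamma+H_{\ell}-H_{N}-\log x)(\gamma+H_{r-1}-H_{N})+3\psi'(r+\ell)\Big)\\&+\sum_{\substack{k=0\\ k\ne r-1}}^{N}\binom{N}{k}x^{N-k}\zeta(r-k)\zeta(k-r+2)+O(|\varepsilon|).\end{aligned}$$ The implied constants may depend on $r,s,\ell,x$. -/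

import Mathlib

open Finset Filter Topology Asymptotics
open scoped Nat

noncomputable section

/-- The term of index `(n, m)`, with `n, m ≥ 1`, of the generalized Mordell-Tornheim double series,
`1 / (n ^ r * m ^ s * (n + m * x) ^ t)`. The index `p : ℕ × ℕ` stands for `n = p.1 + 1`,
`m = p.2 + 1`. -/
def thetaTerm (r s t : ℂ) (x : ℝ) (p : ℕ × ℕ) : ℂ :=
  1 / (((p.1 + 1 : ℕ) : ℂ) ^ r * ((p.2 + 1 : ℕ) : ℂ) ^ s *
    (((p.1 + 1 : ℕ) + (p.2 + 1 : ℕ) * x : ℝ) : ℂ) ^ t)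

/-- The region of absolute convergence of the double series. -/
def thetaRegion (r s t : ℂ) : Prop :=
  1 < (r + t).re ∧ 1 < (s + t).re ∧ 2 < (r + s + t).re

/-- `F` is the meromorphic continuation to the whole plane, in the variable `t`, of the sum of the
double series: `F` is meromorphic on `ℂ` and the series converges absolutely to `F t` at each `t` in
the region. The normal form means that `F` is continuous at each point that is not a pole (and has
the value `0` at the poles), so that there is at most one such `F`. -/
structure IsThetaContinuation (r s : ℂ) (x : ℝ) (F : ℂ → ℂ) : Prop where
  meromorphic : MeromorphicNFOn F Set.univ
  hasSum : ∀ t : ℂ, thetaRegion r s t → HasSum (thetaTerm r s t x) (F t)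

open Classical in
/-- The generalized Mordell-Tornheim zeta function `Θ(r, s, t, x)`: for fixed `r`, `s`, `x`, the
meromorphic continuation in `t` of the double series (and `0` if there were no continuation). -/
def Theta (r s t : ℂ) (x : ℝ) : ℂ :=
  if h : ∃ F : ℂ → ℂ, IsThetaContinuation r s x F then h.choose t else 0

/-- Euler's constant, as a complex number. -/
def eulerGamma : ℂ := (Real.eulerMascheroniConstant : ℂ)

/-- The harmonic number `H n = 1 + 1/2 + ⋯ + 1/n`, as a complex number. -/
def harmonicC (n : ℕ) : ℂ := ((harmonic n : ℚ) : ℂ)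

end

/-!
The product `Γ(t) Θ(r, s, t, x)` is the Mellin transform at `t` of `Li_r(e^{-u}) Li_s(e^{-xu})`, as
one sees by expanding both polylogarithms and integrating term by term (`mellin_polylogExp_mul`).
The poles of such a transform are read off from the expansion of the function as `u → 0⁺`: a term
`u ^ α * (log u) ^ β` contributes `(-1) ^ β * β! / (t + α) ^ (β + 1)`, and a remainder `O(u ^ M)`
contributes a holomorphic function on `-M < Re t` (`exists_mellin_eq_polar_add`). Gluing over all
`M` gives the meromorphic continuation (`exists_isThetaContinuation`). What remains is to find the
expansion of `Li_s(e^{-u})`, and to extract from the product the coefficients with `α = r + ℓ - 1`.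

The expansion (`polylogExp_sub_expansion_isBigO`) is
`Li_s(e^{-u}) ~ Γ(1 - s) u^{s-1} + ∑ ζ(s - k) (-u)^k / k!` if `s` is not a positive integer. If
`s = n + 1`, the singular term and the undefined term `k = n` are replaced together by
`(-u)^n / n! * (H_n - log u)`. As `d/du Li_s(e^{-u}) = -Li_{s-1}(e^{-u})`, the expansion for `s`
comes from that for `s - 1` by integration, up to the constant term.
* If `Re s < 0`, Poisson summation gives Lipschitz's formula
  `Li_s(e^{-u}) = Γ(1 - s) ∑ (u + 2πik)^{s-1}` over `k ∈ ℤ` (`polylogExp_eq_tsum_lipschitz`), where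
  the terms with `k ≠ 0` are bounded. This starts the induction.
* The constant term at a non-integer `s`, or at an integer `s ≤ 0`, is the residue at `t = 0` of
  the Mellin transform `Γ(t) ζ(s + t)` of `Li_s(e^{-u})`, that is `ζ(s)`
  (`tendsto_polylogExp_sub_of_isBigO`). For an integer `s ≥ 2` it is `ζ(s)` by dominated
  convergence, and for `s = 1` it vanishes since `Li_1(e^{-u}) = -log(1 - e^{-u})`.

Finally, at `t = -N + ε` with `N = r + ℓ - 1`, the reflection formula gives `1/Γ(t)` up to
`O(ε ^ 4)` (`isBigO_inv_Gamma_sub`), with the first two derivatives of `Γ` at `N + 1` expressed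
through `ψ(N + 1) = H_N - γ` and `ψ'(N + 1)`. Multiplying this with a polar part of order at most
three gives the Laurent expansion of `Θ` in terms of three coefficients of the product
(`exists_Theta_sub_isBigO`). These are a convolution of `ζ(r - k)` and `ζ(s - N + k)`, which is the
binomial sum of the theorem, plus the contributions of the singular terms: that of the first factor
gives the pole `ζ(s - ℓ) / ε`, and that of the second factor contributes only if `s` is an integer
at most `N + 1`. The two singular terms meet, and make a double pole, exactly when `s = ℓ + 1`.
-/

noncomputable section

/-! ### Finite sums of powers times powers of a logarithm, and their Mellin transforms -/

/-- Formal finite sums `∑ c * u ^ α * (log u) ^ β` with `α : ℂ` and `β : ℕ`, encoded as the monoid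
algebra on the exponents `(α, β)`, so that the product of two expansions is the product of the
algebra. The coefficient of `u ^ α * (log u) ^ β` in `p` is `p.coeff (α, β)`. -/
abbrev LogPowerSum : Type := AddMonoidAlgebra ℂ (ℂ × ℕ)

namespace LogPowerSum

/-- At a fixed `u > 0`, the map `(α, β) ↦ u ^ α * (log u) ^ β` from exponents to values, which turns
sums into products. -/
def monomialHom (u : ℝ) (hu : 0 < u) : Multiplicative (ℂ × ℕ) →* ℂ where
  toFun a := (u : ℂ) ^ a.toAdd.1 * (Real.log u : ℂ) ^ a.toAdd.2
  map_one' := by simp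
  map_mul' a b := by
    simp only [toAdd_mul, Prod.fst_add, Prod.snd_add]
    rw [Complex.cpow_add _ _ (by exact_mod_cast hu.ne'), pow_add]
    ring

/-- The value at `u` of the sum `p`, meaningful for `u > 0`. -/
def eval (u : ℝ) (p : LogPowerSum) : ℂ :=
  p.coeff.sum fun a c => c * ((u : ℂ) ^ a.1 * (Real.log u : ℂ) ^ a.2)

lemma eval_add (u : ℝ) (p q : LogPowerSum) : eval u (p + q) = eval u p + eval u q := by
  simp only [eval, AddMonoidAlgebra.coeff_add]
  exact Finsupp.sum_add_index' (by simp) (by intros; ring)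

lemma eval_zero (u : ℝ) : eval u 0 = 0 := by simp [eval]

lemma eval_single (u : ℝ) (a : ℂ × ℕ) (c : ℂ) :
    eval u (AddMonoidAlgebra.single a c) = c * ((u : ℂ) ^ a.1 * (Real.log u : ℂ) ^ a.2) := by
  simp [eval]

lemma eval_sum (u : ℝ) {ι : Type*} (s : Finset ι) (p : ι → LogPowerSum) :
    eval u (∑ i ∈ s, p i) = ∑ i ∈ s, eval u (p i) := by
  classical
  induction s using Finset.induction_on with
  | empty => simp [eval_zero]
  | insert a s ha ih => rw [Finset.sum_insert ha, Finset.sum_insert ha, eval_add, ih]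

lemma eval_mul {u : ℝ} (hu : 0 < u) (p q : LogPowerSum) :
    eval u (p * q) = eval u p * eval u q := by
  have h : ∀ p : LogPowerSum, eval u p = AddMonoidAlgebra.lift ℂ ℂ (ℂ × ℕ) (monomialHom u hu) p := by
    intro p
    rw [AddMonoidAlgebra.lift_apply']
    rfl
  rw [h, h, h, map_mul]

/-- The Mellin transform at `t` of the restriction of `p` to `(0, 1]`, continued to all `t`: the
monomial `u ^ α * (log u) ^ β` gives `(-1) ^ β * β! / (t + α) ^ (β + 1)`. -/
def polar (t : ℂ) (p : LogPowerSum) : ℂ :=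
  p.coeff.sum fun a c => c * ((-1) ^ a.2 * (a.2 ! : ℂ) / (t + a.1) ^ (a.2 + 1))

lemma polar_add (u : ℂ) (p q : LogPowerSum) : polar u (p + q) = polar u p + polar u q := by
  simp only [polar, AddMonoidAlgebra.coeff_add]
  exact Finsupp.sum_add_index' (by simp) (by intros; ring)

lemma polar_zero (u : ℂ) : polar u 0 = 0 := by simp [polar]

lemma polar_single (t : ℂ) (a : ℂ × ℕ) (c : ℂ) :
    polar t (AddMonoidAlgebra.single a c) =
      c * ((-1) ^ a.2 * (a.2 ! : ℂ) / (t + a.1) ^ (a.2 + 1)) := by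
  simp [polar]

lemma polar_meromorphicAt (p : LogPowerSum) (t : ℂ) :
    MeromorphicAt (fun t => polar t p) t := by
  unfold polar Finsupp.sum
  fun_prop

lemma continuousOn_eval (p : LogPowerSum) : ContinuousOn (fun u => eval u p) (Set.Ioi 0) := by
  induction p using AddMonoidAlgebra.induction_linear with
  | zero => simpa only [eval_zero] using continuousOn_const
  | add p q hp hq => simpa only [eval_add] using hp.fun_add hq
  | single a c =>
    simp only [eval_single]
    refine continuousOn_const.mul (ContinuousOn.mul ?_ ?_)
    · intro u hu
      exact (Complex.continuousAt_ofReal_cpow_const _ _ (Or.inr (ne_of_gt hu))).continuousWithinAt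
    · refine ContinuousOn.pow (Complex.continuous_ofReal.comp_continuousOn ?_) _
      exact Real.continuousOn_log.mono (fun u hu => ne_of_gt hu)

lemma isBigO_monomial (α : ℂ) (β : ℕ) {b : ℝ} (hb : -α.re < b) :
    (fun u : ℝ => (u : ℂ) ^ α * (Real.log u : ℂ) ^ β) =O[𝓝[>] 0] fun u => u ^ (-b) := by
  induction β generalizing b with
  | zero =>
    simp only [pow_zero, mul_one]
    refine IsBigO.of_bound 1 ?_
    filter_upwards [Ioo_mem_nhdsGT (zero_lt_one (α := ℝ))] with u hu
    rw [Complex.norm_cpow_eq_rpow_re_of_pos hu.1, one_mul, Real.norm_of_nonneg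
      (Real.rpow_nonneg hu.1.le _)]
    exact Real.rpow_le_rpow_of_exponent_ge hu.1 hu.2.le (by linarith)
  | succ β ih =>
    obtain ⟨b', h1, h2⟩ := exists_between hb
    have := isBigO_rpow_zero_log_smul h2 (ih h1)
    refine this.congr_left fun u => ?_
    simp only [Complex.real_smul]
    ring

/-- Each factor `log u` differentiates the Mellin transform once more in `t`. -/
lemma hasMellin_monomial (α : ℂ) (β : ℕ) {t : ℂ} (ht : -α.re < t.re) :
    HasMellin ((Set.Ioc 0 1).indicator fun u : ℝ => (u : ℂ) ^ α * (Real.log u : ℂ) ^ β) t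
      ((-1) ^ β * (β ! : ℂ) / (t + α) ^ (β + 1)) := by
  induction β generalizing t with
  | zero => simpa using hasMellin_cpow_Ioc α (s := t) (by linarith)
  | succ β ih =>
    obtain ⟨b, h1, h2⟩ := exists_between ht
    have hloc : MeasureTheory.LocallyIntegrableOn
        ((Set.Ioc 0 1).indicator fun u : ℝ => (u : ℂ) ^ α * (Real.log u : ℂ) ^ β) (Set.Ioi 0) := by
      have hc := (continuousOn_eval (AddMonoidAlgebra.single (α, β) 1)).locallyIntegrableOn
        measurableSet_Ioi (μ := MeasureTheory.volume)
      simp only [eval_single, one_mul] at hc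
      rw [MeasureTheory.locallyIntegrableOn_iff isOpen_Ioi.isLocallyClosed] at hc ⊢
      exact fun k hk hk' => (hc k hk hk').indicator measurableSet_Ioc
    have htop : ((Set.Ioc 0 1).indicator fun u : ℝ => (u : ℂ) ^ α * (Real.log u : ℂ) ^ β)
        =O[atTop] fun u : ℝ => u ^ (-(t.re + 1)) := by
      refine IsBigO.of_bound 1 ?_
      filter_upwards [eventually_gt_atTop 1] with u hu
      rw [Set.indicator_of_notMem (by simp [hu])]
      simp only [norm_zero, one_mul]
      positivity
    have hbot : ((Set.Ioc 0 1).indicator fun u : ℝ => (u : ℂ) ^ α * (Real.log u : ℂ) ^ β)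
        =O[𝓝[>] 0] fun u : ℝ => u ^ (-b) := by
      refine (isBigO_monomial α β h1).congr' ?_ EventuallyEq.rfl
      filter_upwards [Ioo_mem_nhdsGT (zero_lt_one (α := ℝ))] with u hu
      rw [Set.indicator_of_mem (show u ∈ Set.Ioc (0 : ℝ) 1 from ⟨hu.1, hu.2.le⟩)]
    obtain ⟨hconv, hder⟩ := mellin_hasDerivAt_of_isBigO_rpow hloc htop (by linarith) hbot h2
    have hfun : (fun u : ℝ => Real.log u •
        ((Set.Ioc 0 1).indicator fun u : ℝ => (u : ℂ) ^ α * (Real.log u : ℂ) ^ β) u) =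
        (Set.Ioc 0 1).indicator fun u : ℝ => (u : ℂ) ^ α * (Real.log u : ℂ) ^ (β + 1) := by
      funext u
      by_cases hu : u ∈ Set.Ioc (0 : ℝ) 1
      · simp only [Set.indicator_of_mem hu, Complex.real_smul]
        ring
      · simp [Set.indicator_of_notMem hu]
    rw [hfun] at hconv hder
    refine ⟨hconv, ?_⟩
    have hne : t + α ≠ 0 := by
      intro h
      have := congrArg Complex.re h
      simp only [Complex.add_re, Complex.zero_re] at this
      linarith
    have hder' : HasDerivAt (fun t : ℂ => (-1) ^ β * (β ! : ℂ) / (t + α) ^ (β + 1))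
        ((-1) ^ (β + 1) * ((β + 1)! : ℂ) / (t + α) ^ (β + 1 + 1)) t := by
      have h1 : HasDerivAt (fun t : ℂ => (t + α) ^ (β + 1))
          (((β + 1 : ℕ) : ℂ) * (t + α) ^ β * 1) t := by
        simpa using ((hasDerivAt_id t).add_const α).fun_pow (β + 1)
      have h2 := (hasDerivAt_const t ((-1) ^ β * (β ! : ℂ))).div h1 (pow_ne_zero _ hne)
      refine h2.congr_deriv ?_
      rw [Nat.factorial_succ]
      push_cast
      field_simp
      ring
    refine hder.unique (hder'.congr_of_eventuallyEq ?_)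
    have hopen : IsOpen {z : ℂ | -α.re < z.re} := isOpen_lt continuous_const Complex.continuous_re
    filter_upwards [hopen.mem_nhds ht] with z hz
    exact (ih hz).2

lemma exists_hasMellin_eval (p : LogPowerSum) : ∃ T : ℝ, ∀ t : ℂ, T < t.re →
    HasMellin ((Set.Ioc 0 1).indicator fun u : ℝ => eval u p) t (polar t p) := by
  induction p using AddMonoidAlgebra.induction_linear with
  | zero =>
    refine ⟨0, fun t _ => ?_⟩
    simp [eval_zero, polar_zero, HasMellin, mellin, MellinConvergent]
  | add p q hp hq =>
    obtain ⟨T₁, h₁⟩ := hp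
    obtain ⟨T₂, h₂⟩ := hq
    refine ⟨max T₁ T₂, fun t ht => ?_⟩
    have a := h₁ t ((le_max_left _ _).trans_lt ht)
    have b := h₂ t ((le_max_right _ _).trans_lt ht)
    have := hasMellin_add a.1 b.1
    rw [a.2, b.2, ← polar_add] at this
    convert this using 1
    funext u
    simp only [eval_add, Set.indicator_apply]
    split_ifs <;> simp
  | single a c =>
    refine ⟨-a.1.re, fun t ht => ?_⟩
    have := hasMellin_const_smul (hasMellin_monomial a.1 a.2 ht).1 c
    rw [(hasMellin_monomial a.1 a.2 ht).2] at this
    rw [polar_single]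
    rw [smul_eq_mul] at this
    convert this using 1
    funext u
    simp only [eval_single, Set.indicator_apply, smul_eq_mul]
    split_ifs <;> simp

/-- The principal part of `p.polar` at `-N`, when no power of the logarithm exceeds two. -/
lemma exists_analyticAt_polar (p : LogPowerSum) (N : ℂ) (hdeg : ∀ a ∈ p.coeff.support, a.2 ≤ 2) :
    ∃ h : ℂ → ℂ, AnalyticAt ℂ h (-N) ∧ ∀ t, polar t p =
      p.coeff (N, 0) / (t + N) - p.coeff (N, 1) / (t + N) ^ 2 + 2 * p.coeff (N, 2) / (t + N) ^ 3
        + h t := by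
  classical
  refine ⟨fun t => ∑ a ∈ p.coeff.support with a.1 ≠ N,
    p.coeff a * ((-1) ^ a.2 * (a.2 ! : ℂ) / (t + a.1) ^ (a.2 + 1)), ?_, fun t => ?_⟩
  · refine Finset.analyticAt_fun_sum _ fun a ha => ?_
    have hne : -N + a.1 ≠ 0 := by
      intro h
      exact (Finset.mem_filter.1 ha).2 (by linear_combination h)
    have := pow_ne_zero (a.2 + 1) hne
    fun_prop (disch := assumption)
  · unfold polar Finsupp.sum
    rw [← Finset.sum_filter_add_sum_filter_not p.coeff.support (fun a => a.1 = N)]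
    congr 1
    have : ∑ a ∈ p.coeff.support with a.1 = N,
        p.coeff a * ((-1) ^ a.2 * (a.2 ! : ℂ) / (t + a.1) ^ (a.2 + 1)) =
        ∑ b ∈ Finset.range 3, p.coeff (N, b) * ((-1) ^ b * (b ! : ℂ) / (t + N) ^ (b + 1)) := by
      refine Finset.sum_of_injOn (fun a => a.2) ?_ ?_ ?_ ?_
      · rintro ⟨a, b⟩ h1 ⟨a', b'⟩ h2 h
        simp only [coe_filter, Set.mem_ofPred_eq] at h1 h2 h
        simp [h1.2, h2.2, h]
      · rintro a ha
        simp only [coe_filter, Set.mem_ofPred_eq] at ha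
        have := hdeg a ha.1
        simp only [coe_range, Set.mem_Iio]
        omega
      · intro b _ hb
        have : p.coeff (N, b) = 0 := by
          by_contra h
          exact hb ⟨(N, b), by simp [h], rfl⟩
        simp [this]
      · rintro ⟨a, b⟩ ha
        simp only [mem_filter] at ha
        simp [ha.2]
    rw [this]
    simp [Finset.sum_range_succ]
    ring

end LogPowerSum

/-- If `f` decays rapidly at infinity and equals `p` up to `O(u ^ K)` at `0`, its Mellin transform
continues to `-K < Re t`, with the poles prescribed by `p`. -/
theorem exists_mellin_eq_polar_add {f : ℝ → ℂ} (hf : ContinuousOn f (Set.Ioi 0))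
    (htop : ∀ a : ℝ, f =O[atTop] fun u : ℝ => u ^ (-a)) {K : ℝ} {p : LogPowerSum}
    (hp : (fun u => f u - p.eval u) =O[𝓝[>] 0] fun u : ℝ => u ^ K) :
    ∃ h : ℂ → ℂ, DifferentiableOn ℂ h {t | -K < t.re} ∧
      ∃ T : ℝ, ∀ t : ℂ, T < t.re → mellin f t = p.polar t + h t := by
  set E : ℝ → ℂ := (Set.Ioc 0 1).indicator fun u : ℝ => p.eval u with hE
  have hloc : MeasureTheory.LocallyIntegrableOn (fun u => f u - E u) (Set.Ioi 0) := by
    have h1 := hf.locallyIntegrableOn measurableSet_Ioi (μ := MeasureTheory.volume)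
    have h2 := p.continuousOn_eval.locallyIntegrableOn measurableSet_Ioi
      (μ := MeasureTheory.volume)
    rw [MeasureTheory.locallyIntegrableOn_iff isOpen_Ioi.isLocallyClosed] at h1 h2 ⊢
    exact fun k hk hk' => (h1 k hk hk').sub ((h2 k hk hk').indicator measurableSet_Ioc)
  have htop' : ∀ a : ℝ, (fun u => f u - E u) =O[atTop] fun u : ℝ => u ^ (-a) := by
    intro a
    refine (htop a).congr' ?_ EventuallyEq.rfl
    filter_upwards [eventually_gt_atTop 1] with u hu
    rw [hE, Set.indicator_of_notMem (by simp [hu]), sub_zero]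
  have hbot : (fun u => f u - E u) =O[𝓝[>] 0] fun u : ℝ => u ^ (-(-K)) := by
    rw [neg_neg]
    refine hp.congr' ?_ EventuallyEq.rfl
    filter_upwards [Ioo_mem_nhdsGT (zero_lt_one (α := ℝ))] with u hu
    rw [hE, Set.indicator_of_mem (show u ∈ Set.Ioc (0 : ℝ) 1 from ⟨hu.1, hu.2.le⟩)]
  obtain ⟨T, hT⟩ := p.exists_hasMellin_eval
  refine ⟨mellin fun u => f u - E u, fun t ht => ?_, max T (-K), fun t ht => ?_⟩
  · exact (mellin_differentiableAt_of_isBigO_rpow hloc (htop' (t.re + 1)) (by linarith) hbot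
      ht).differentiableWithinAt
  · have h1 := hT t ((le_max_left _ _).trans_lt ht)
    have h2 : MellinConvergent (fun u => f u - E u) t :=
      mellinConvergent_of_isBigO_rpow hloc (htop' (t.re + 1)) (by linarith) hbot
        ((le_max_right _ _).trans_lt ht)
    have h3 := hasMellin_add h1.1 h2
    rw [h1.2] at h3
    rw [← h3.2]
    congr 1
    funext u
    ring

/-- The identity theorem for meromorphic functions. -/
theorem MeromorphicOn.eventuallyEq_nhdsNE_of_isPreconnected {f g : ℂ → ℂ} {U : Set ℂ}
    (hf : MeromorphicOn f U) (hg : MeromorphicOn g U) (hU : IsPreconnected U) {z₀ z : ℂ}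
    (hz₀ : z₀ ∈ U) (hz : z ∈ U) (h : f =ᶠ[𝓝[≠] z₀] g) : f =ᶠ[𝓝[≠] z] g := by
  have key : meromorphicOrderAt (f - g) z = ⊤ := by
    by_contra hne
    refine (hf.sub hg).meromorphicOrderAt_ne_top_of_isPreconnected hU hz hz₀ hne ?_
    rw [meromorphicOrderAt_eq_top_iff]
    filter_upwards [h] with w hw
    simp [hw]
  rw [meromorphicOrderAt_eq_top_iff] at key
  filter_upwards [key] with w hw
  simpa [sub_eq_zero] using hw

/-! ### The polylogarithm of `exp (-u)` -/

/-- The term `(m + 1) ^ (-s) * e ^ (-(m + 1) u)` of the polylogarithm `Li_s(e^{-u})`. -/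
def polylogTerm (s : ℂ) (m : ℕ) (u : ℝ) : ℂ :=
  ((m + 1 : ℕ) : ℂ) ^ (-s) * (Real.exp (-((m + 1 : ℕ) : ℝ) * u) : ℝ)

/-- The polylogarithm `Li_s(e^{-u}) = ∑_{m ≥ 1} m ^ (-s) * e ^ (-m u)`, for `u > 0`. -/
def polylogExp (s : ℂ) (u : ℝ) : ℂ := ∑' m : ℕ, polylogTerm s m u

lemma norm_polylogTerm (s : ℂ) (m : ℕ) (u : ℝ) : ‖polylogTerm s m u‖ =
    ((m + 1 : ℕ) : ℝ) ^ (-s.re) * Real.exp (-((m + 1 : ℕ) : ℝ) * u) := by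
  rw [polylogTerm, norm_mul, Complex.norm_natCast_cpow_of_pos m.succ_pos, Complex.norm_real,
    Real.norm_of_nonneg (Real.exp_nonneg _), Complex.neg_re]

lemma summable_norm_polylogTerm (s : ℂ) {u : ℝ} (hu : 0 < u) :
    Summable fun m => ‖polylogTerm s m u‖ := by
  have h := (summable_nat_add_iff 1).2
    (Real.summable_pow_mul_exp_neg_nat_mul ⌈|s.re|⌉₊ hu)
  refine Summable.of_nonneg_of_le (fun m => norm_nonneg _) (fun m => ?_) h
  rw [norm_polylogTerm]
  have h1 : ((m + 1 : ℕ) : ℝ) ^ (-s.re) ≤ ((m + 1 : ℕ) : ℝ) ^ ⌈|s.re|⌉₊ := by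
    rw [← Real.rpow_natCast]
    refine Real.rpow_le_rpow_of_exponent_le (by simp) ?_
    exact (neg_le_abs _).trans (Nat.le_ceil _)
  have h2 : -((m + 1 : ℕ) : ℝ) * u = -u * ((m + 1 : ℕ) : ℝ) := by ring
  rw [h2]
  gcongr

lemma hasSum_polylogExp (s : ℂ) {u : ℝ} (hu : 0 < u) :
    HasSum (fun m => polylogTerm s m u) (polylogExp s u) :=
  (summable_norm_polylogTerm s hu).of_norm.hasSum

lemma hasDerivAt_polylogExp (s : ℂ) {u : ℝ} (hu : 0 < u) :
    HasDerivAt (polylogExp s) (-polylogExp (s - 1) u) u := by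
  rw [polylogExp, ← tsum_neg]
  refine hasDerivAt_tsum_of_isPreconnected (g := fun m => polylogTerm s m)
    (g' := fun m u => -polylogTerm (s - 1) m u) (t := Set.Ioi (u / 2)) (y₀ := u)
    (summable_norm_polylogTerm (s - 1) (half_pos hu)) isOpen_Ioi isPreconnected_Ioi ?_ ?_
    (half_lt_self hu) (hasSum_polylogExp s hu).summable (half_lt_self hu)
  · intro m y _
    have h1 : HasDerivAt (fun y : ℝ => Real.exp (-((m + 1 : ℕ) : ℝ) * y))
        (Real.exp (-((m + 1 : ℕ) : ℝ) * y) * (-((m + 1 : ℕ) : ℝ))) y := by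
      simpa using (HasDerivAt.exp ((hasDerivAt_id y).const_mul (-((m + 1 : ℕ) : ℝ))))
    have h2 := h1.ofReal_comp.const_mul (((m + 1 : ℕ) : ℂ) ^ (-s))
    refine h2.congr_deriv ?_
    have h3 : ((m + 1 : ℕ) : ℂ) ≠ 0 := Nat.cast_ne_zero.2 m.succ_ne_zero
    rw [polylogTerm, neg_sub, sub_eq_neg_add, Complex.cpow_add _ _ h3, Complex.cpow_one]
    push_cast
    ring
  · intro m y hy
    rw [norm_neg, norm_polylogTerm, norm_polylogTerm]
    have : u / 2 ≤ y := le_of_lt hy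
    refine mul_le_mul_of_nonneg_left (Real.exp_le_exp.2 ?_) (by positivity)
    rw [neg_mul, neg_mul, neg_le_neg_iff]
    gcongr

lemma continuousOn_polylogExp (s : ℂ) : ContinuousOn (polylogExp s) (Set.Ioi 0) :=
  fun _ hu => (hasDerivAt_polylogExp s hu).continuousAt.continuousWithinAt

lemma polylogExp_isBigO_exp (s : ℂ) : polylogExp s =O[atTop] fun u : ℝ => Real.exp (-1 * u) := by
  refine IsBigO.of_bound (Real.exp 1 * ∑' m, ‖polylogTerm s m 1‖) ?_
  filter_upwards [eventually_ge_atTop 1] with u hu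
  have hs := summable_norm_polylogTerm s (zero_lt_one.trans_le hu)
  refine (norm_tsum_le_tsum_norm hs).trans ?_
  rw [Real.norm_of_nonneg (Real.exp_nonneg _), mul_right_comm, ← tsum_mul_left]
  refine hs.tsum_le_tsum (fun m => ?_) ((summable_norm_polylogTerm s one_pos).mul_left _)
  rw [norm_polylogTerm, norm_polylogTerm, mul_left_comm, ← Real.exp_add, ← Real.exp_add]
  refine mul_le_mul_of_nonneg_left (Real.exp_le_exp.2 ?_) (by positivity)
  push_cast
  nlinarith [mul_nonneg (Nat.cast_nonneg (α := ℝ) m) (sub_nonneg.2 hu)]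

lemma polylogExp_isBigO_rpow_atTop (s : ℂ) (a : ℝ) :
    polylogExp s =O[atTop] fun u : ℝ => u ^ (-a) :=
  (polylogExp_isBigO_exp s).trans (isLittleO_exp_neg_mul_rpow_atTop one_pos _).isBigO

/-! ### The Laplace transform of a power at a complex argument -/

/-- Both sides are holomorphic in `z` on the right half-plane and agree for real `z`. -/
theorem Complex.integral_cpow_mul_exp_neg_mul_Ioi_complex {a z : ℂ} (ha : 0 < a.re) (hz : 0 < z.re) :
    ∫ v : ℝ in Set.Ioi 0, (v : ℂ) ^ (a - 1) * Complex.exp (-(z * v)) =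
      z ^ (-a) * Complex.Gamma a := by
  set U : Set ℂ := {z | 0 < z.re} with hU
  have hUo : IsOpen U := isOpen_lt continuous_const Complex.continuous_re
  have hmeas : ∀ (b z : ℂ), MeasureTheory.AEStronglyMeasurable
      (fun v : ℝ => (v : ℂ) ^ b * Complex.exp (-(z * v)))
      (MeasureTheory.volume.restrict (Set.Ioi 0)) := by
    intro b z
    refine ContinuousOn.aestronglyMeasurable (fun v hv => ?_) measurableSet_Ioi
    have h1 := Complex.continuousAt_ofReal_cpow_const v b (Or.inr (ne_of_gt hv))
    have h2 : ContinuousAt (fun v : ℝ => Complex.exp (-(z * v))) v := by fun_prop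
    exact (h1.mul h2).continuousWithinAt
  have hint : ∀ (b : ℂ) {c : ℝ}, -1 < b.re → 0 < c → MeasureTheory.IntegrableOn
      (fun v : ℝ => v ^ b.re * Real.exp (-c * v)) (Set.Ioi 0) := by
    intro b c hb hc
    simpa using integrableOn_rpow_mul_exp_neg_mul_rpow hb one_pos hc
  have hnorm : ∀ (b z : ℂ) (v : ℝ), 0 < v → ‖(v : ℂ) ^ b * Complex.exp (-(z * v))‖ =
      v ^ b.re * Real.exp (-z.re * v) := by
    intro b z v hv
    rw [norm_mul, Complex.norm_cpow_eq_rpow_re_of_pos hv, Complex.norm_exp]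
    simp
  have hdiff : DifferentiableOn ℂ
      (fun z : ℂ => ∫ v : ℝ in Set.Ioi 0, (v : ℂ) ^ (a - 1) * Complex.exp (-(z * v))) U := by
    intro z₀ hz₀
    have hz₀' : 0 < z₀.re := hz₀
    have hs : {z : ℂ | z₀.re / 2 < z.re} ∈ 𝓝 z₀ :=
      (isOpen_lt continuous_const Complex.continuous_re).mem_nhds (half_lt_self hz₀')
    refine (hasDerivAt_integral_of_dominated_loc_of_deriv_le (𝕜 := ℂ)
      (F := fun z (v : ℝ) => (v : ℂ) ^ (a - 1) * Complex.exp (-(z * v)))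
      (F' := fun z (v : ℝ) => -((v : ℂ) ^ a * Complex.exp (-(z * v))))
      (bound := fun v => v ^ a.re * Real.exp (-(z₀.re / 2) * v)) hs
      (Eventually.of_forall fun z => hmeas _ z) ?_ (hmeas _ _).neg ?_
      (hint a (by linarith) (half_pos hz₀')) ?_).2.differentiableAt.differentiableWithinAt
    · refine (hint (a - 1) (by simpa using ha) hz₀').mono' (hmeas _ _) ?_
      filter_upwards [MeasureTheory.ae_restrict_mem measurableSet_Ioi] with v hv
      rw [hnorm _ _ _ hv]
    · filter_upwards [MeasureTheory.ae_restrict_mem measurableSet_Ioi] with v hv z hz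
      rw [norm_neg, hnorm _ _ _ hv]
      have hv' : (0 : ℝ) < v := hv
      have hz' : z₀.re / 2 ≤ z.re := le_of_lt hz
      have := mul_le_mul_of_nonneg_right hz' hv'.le
      refine mul_le_mul_of_nonneg_left (Real.exp_le_exp.2 ?_) (by positivity)
      linarith
    · filter_upwards [MeasureTheory.ae_restrict_mem measurableSet_Ioi] with v hv z hz
      have h1 : HasDerivAt (fun z : ℂ => Complex.exp (-(z * v)))
          (Complex.exp (-(z * v)) * (-(1 * (v : ℂ)))) z :=
        (((hasDerivAt_id z).mul_const (v : ℂ)).neg).cexp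
      refine (h1.const_mul ((v : ℂ) ^ (a - 1))).congr_deriv ?_
      have hv0 : (v : ℂ) ≠ 0 := by exact_mod_cast (ne_of_gt hv)
      have h2 : (v : ℂ) ^ a = (v : ℂ) ^ (a - 1) * v := by
        rw [Complex.cpow_sub _ _ hv0, Complex.cpow_one, div_mul_cancel₀ _ hv0]
      rw [h2]
      ring
  have hdiff' : DifferentiableOn ℂ (fun z : ℂ => z ^ (-a) * Complex.Gamma a) U := by
    intro z hz
    have : z ∈ Complex.slitPlane := Or.inl hz
    exact ((differentiableAt_id.cpow_const this).mul_const _).differentiableWithinAt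
  have hpre : IsPreconnected U := (convex_halfSpace_re_gt 0).isPreconnected
  refine (hdiff.analyticOnNhd hUo).eqOn_of_preconnected_of_frequently_eq
    (hdiff'.analyticOnNhd hUo) hpre (z₀ := 1) (by simp [hU]) ?_ hz
  -- the points `1 + 1 / (n + 1)` are real, tend to `1` and differ from it
  have hfreq : Tendsto (fun n : ℕ => ((1 + 1 / ((n : ℝ) + 1) : ℝ) : ℂ)) atTop (𝓝[≠] 1) := by
    rw [tendsto_nhdsWithin_iff]
    constructor
    · have := (tendsto_one_div_add_atTop_nhds_zero_nat (𝕜 := ℝ)).const_add 1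
      rw [add_zero] at this
      exact_mod_cast (Complex.continuous_ofReal.tendsto (1 : ℝ)).comp this
    · refine Eventually.of_forall fun n => ?_
      have h0 : 0 < 1 / ((n : ℝ) + 1) := by positivity
      have h1 : (1 + 1 / ((n : ℝ) + 1)) ≠ 1 := by linarith
      rw [Set.mem_compl_singleton_iff]
      exact fun h => h1 (Complex.ofReal_eq_one.1 h)
  refine hfreq.frequently (Eventually.frequently (Eventually.of_forall fun n => ?_))
  have hpos : 0 < 1 + 1 / ((n : ℝ) + 1) := by positivity
  rw [Complex.integral_cpow_mul_exp_neg_mul_Ioi ha hpos, one_div, Complex.inv_cpow,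
    Complex.cpow_neg]
  rw [Complex.arg_ofReal_of_nonneg hpos.le]
  exact Real.pi_ne_zero.symm

/-! ### The formula of Lipschitz -/

lemma Complex.norm_cpow_le_rpow_mul_exp {z : ℂ} (hz : z ≠ 0) (w : ℂ) :
    ‖z ^ w‖ ≤ ‖z‖ ^ w.re * Real.exp (Real.pi * |w.im|) := by
  rw [Complex.norm_cpow_of_ne_zero hz, div_eq_mul_inv, ← Real.exp_neg]
  refine mul_le_mul_of_nonneg_left (Real.exp_le_exp.2 ?_) (by positivity)
  calc -(z.arg * w.im) ≤ |z.arg * w.im| := neg_le_abs _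
    _ = |z.arg| * |w.im| := abs_mul _ _
    _ ≤ _ := by gcongr; exact Complex.abs_arg_le_pi z

/-- The bound is uniform in `u` and summable in `k`. -/
lemma norm_lipschitz_term_le {s : ℂ} (hs : s.re < 0) (u : ℝ) {k : ℤ} (hk : k ≠ 0) :
    ‖((u : ℂ) + 2 * Real.pi * k * Complex.I) ^ (s - 1)‖ ≤
      |(k : ℝ)| ^ (-(1 - s.re)) * Real.exp (Real.pi * |(s - 1).im|) := by
  have him : ((u : ℂ) + 2 * Real.pi * k * Complex.I).im = 2 * Real.pi * k := by simp
  have hk' : (0 : ℝ) < |(k : ℝ)| := by positivity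
  have h2 : |(k : ℝ)| ≤ ‖(u : ℂ) + 2 * Real.pi * k * Complex.I‖ := by
    refine le_trans ?_ (Complex.abs_im_le_norm _)
    rw [him, abs_mul, abs_of_pos (by positivity : 0 < 2 * Real.pi)]
    nlinarith [Real.pi_gt_three]
  refine (Complex.norm_cpow_le_rpow_mul_exp (norm_pos_iff.1 (hk'.trans_le h2)) _).trans ?_
  refine mul_le_mul_of_nonneg_right ?_ (Real.exp_nonneg _)
  have h3 := Real.rpow_le_rpow_of_nonpos hk' h2 (z := s.re - 1) (by linarith)
  rw [neg_sub]
  simpa using h3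

/-- Lipschitz's formula, from Poisson summation applied to `v ↦ v ^ (-s) * e ^ (-u v)` extended by
`0` to `v ≤ 0`. The condition `Re s < 0` makes this function continuous at `0`. -/
theorem polylogExp_eq_tsum_lipschitz {s : ℂ} (hs : s.re < 0) {u : ℝ} (hu : 0 < u) :
    (Summable fun k : ℤ => ((u : ℂ) + 2 * Real.pi * k * Complex.I) ^ (s - 1)) ∧
    polylogExp s u =
      ∑' k : ℤ, ((u : ℂ) + 2 * Real.pi * k * Complex.I) ^ (s - 1) * Complex.Gamma (1 - s) := by
  have hre : ∀ k : ℤ, ((u : ℂ) + 2 * Real.pi * k * Complex.I).re = u := by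
    intro k; simp
  have hsum : Summable fun k : ℤ => ((u : ℂ) + 2 * Real.pi * k * Complex.I) ^ (s - 1) := by
    have h1 := (Real.summable_abs_int_rpow (b := 1 - s.re) (by linarith)).mul_right
      (Real.exp (Real.pi * |(s - 1).im|))
    refine Summable.of_norm_bounded_eventually h1 ?_
    have : ∀ᶠ k : ℤ in cofinite, k ≠ 0 := (Set.finite_singleton (0 : ℤ)).compl_mem_cofinite
    filter_upwards [this] with k hk
    exact norm_lipschitz_term_le hs u hk
  refine ⟨hsum, ?_⟩
  set f : ℝ → ℂ := fun v => ((max v 0 : ℝ) : ℂ) ^ (-s) * Complex.exp (-(u * v)) with hf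
  have hs0 : -s ≠ 0 := by
    intro h; rw [neg_eq_zero] at h; simp [h] at hs
  have hfneg : ∀ v ≤ 0, f v = 0 := by
    intro v hv
    simp only [hf, max_eq_right hv, Complex.ofReal_zero, Complex.zero_cpow hs0, zero_mul]
  have hcont : Continuous f := by
    have h1 := (Complex.continuous_ofReal_cpow_const (y := -s) (by simpa using hs)).comp
      (continuous_id.max continuous_const : Continuous fun v : ℝ => max v 0)
    have h2 : Continuous fun v : ℝ => Complex.exp (-(u * v)) := by fun_prop
    exact h1.mul h2
  have hdecay : f =O[cocompact ℝ] fun v : ℝ => |v| ^ (-2 : ℝ) := by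
    rw [cocompact_eq_atBot_atTop, isBigO_sup]
    constructor
    · refine IsBigO.of_bound 1 ?_
      filter_upwards [eventually_le_atBot 0] with v hv
      rw [hfneg v hv, norm_zero]
      positivity
    · have h1 : (fun v : ℝ => v ^ (-s.re) * Real.exp (-u * v)) =O[atTop]
          fun v : ℝ => v ^ (-s.re) * v ^ (s.re - 2) :=
        (isBigO_refl _ _).mul (isLittleO_exp_neg_mul_rpow_atTop hu _).isBigO
      refine IsBigO.trans (IsBigO.of_bound 1 ?_) (h1.trans (IsBigO.of_bound 1 ?_))
      · filter_upwards [eventually_gt_atTop 0] with v hv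
        simp only [hf]
        rw [max_eq_left hv.le, norm_mul, Complex.norm_cpow_eq_rpow_re_of_pos hv, Complex.norm_exp,
          one_mul, Real.norm_of_nonneg (by positivity)]
        simp
      · filter_upwards [eventually_gt_atTop 0] with v hv
        rw [← Real.rpow_add hv, one_mul, abs_of_pos hv]
        ring_nf
        rfl
  have hfour : ∀ k : ℤ, FourierTransform.fourier f (k : ℝ) =
      ((u : ℂ) + 2 * Real.pi * k * Complex.I) ^ (s - 1) * Complex.Gamma (1 - s) := by
    intro k
    rw [Real.fourier_real_eq_integral_exp_smul]
    have h1 := Complex.integral_cpow_mul_exp_neg_mul_Ioi_complex (a := 1 - s)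
      (z := (u : ℂ) + 2 * Real.pi * k * Complex.I) (by simp; linarith) (by rw [hre]; exact hu)
    rw [neg_sub] at h1
    rw [← h1, ← MeasureTheory.integral_indicator measurableSet_Ioi]
    congr 1
    funext v
    by_cases hv : 0 < v
    · rw [Set.indicator_of_mem (show v ∈ Set.Ioi (0 : ℝ) from hv)]
      simp only [hf, smul_eq_mul]
      rw [max_eq_left hv.le, mul_left_comm, ← Complex.exp_add]
      congr 2
      · ring
      · push_cast; ring
    · rw [Set.indicator_of_notMem (by simpa using hv), hfneg v (not_lt.1 hv), smul_zero]
  have hP := Real.tsum_eq_tsum_fourier_of_rpow_decay_of_summable hcont one_lt_two hdecay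
    (by simp_rw [hfour]; exact hsum.mul_right _) 0
  simp only [zero_add, hfour, QuotientAddGroup.mk_zero, fourier_eval_zero, mul_one] at hP
  rw [← hP, polylogExp]
  have hinj : Function.Injective (fun m : ℕ => ((m + 1 : ℕ) : ℤ)) := by
    intro a b h
    simpa using h
  rw [← hinj.tsum_eq]
  · refine tsum_congr fun m => ?_
    simp only [hf, polylogTerm]
    rw [max_eq_left (by positivity)]
    push_cast
    congr 2
    ring
  · intro k hk
    have : 0 < k := by
      by_contra h
      exact hk (hfneg _ (by exact_mod_cast not_lt.1 h))
    refine ⟨(k - 1).toNat, ?_⟩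
    simp only
    omega

lemma polylogExp_sub_isBigO_one {s : ℂ} (hs : s.re < 0) :
    (fun u : ℝ => polylogExp s u - Complex.Gamma (1 - s) * (u : ℂ) ^ (s - 1)) =O[𝓝[>] 0]
      fun _ : ℝ => (1 : ℝ) := by
  set C := Real.exp (Real.pi * |(s - 1).im|)
  refine IsBigO.of_bound ((∑' k : ℤ, |(k : ℝ)| ^ (-(1 - s.re)) * C) * ‖Complex.Gamma (1 - s)‖) ?_
  filter_upwards [self_mem_nhdsWithin] with u hu
  obtain ⟨h1, h2⟩ := polylogExp_eq_tsum_lipschitz hs (show 0 < u from hu)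
  rw [tsum_mul_right, h1.tsum_eq_add_tsum_ite 0] at h2
  have h3 : polylogExp s u - Complex.Gamma (1 - s) * (u : ℂ) ^ (s - 1) =
      (∑' k : ℤ, if k = 0 then 0 else ((u : ℂ) + 2 * Real.pi * k * Complex.I) ^ (s - 1)) *
        Complex.Gamma (1 - s) := by
    rw [h2]; simp; ring
  rw [h3, norm_mul, norm_one, mul_one]
  refine mul_le_mul_of_nonneg_right ?_ (norm_nonneg _)
  refine tsum_of_norm_bounded ((Real.summable_abs_int_rpow (by linarith)).mul_right C).hasSum
    fun k => ?_
  split_ifs with hk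
  · rw [norm_zero]; positivity
  · exact norm_lipschitz_term_le hs u hk

/-! ### Integration of estimates at zero -/

lemma exists_norm_sub_le_of_isBigO_pow {f f' : ℝ → ℂ} (hf : ∀ u > 0, HasDerivAt f (f' u) u)
    {K : ℕ} (hf' : f' =O[𝓝[>] 0] fun u : ℝ => u ^ K) :
    ∃ C δ : ℝ, 0 < δ ∧ ∀ v w : ℝ, 0 < v → v ≤ w → w < δ →
      ‖f w - f v‖ ≤ C * w ^ K * (w - v) := by
  obtain ⟨C, hC⟩ := hf'.bound
  obtain ⟨δ, hδ, hsub⟩ := mem_nhdsGT_iff_exists_Ioo_subset.1 hC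
  refine ⟨|C|, δ, hδ, fun v w hv hvw hw => ?_⟩
  have := (convex_Icc v w).norm_image_sub_le_of_norm_hasDerivWithin_le (f := f) (f' := f')
    (C := |C| * w ^ K)
    (fun y hy => (hf y (hv.trans_le hy.1)).hasDerivWithinAt) (fun y hy => ?_)
    (Set.left_mem_Icc.2 hvw) (Set.right_mem_Icc.2 hvw)
  · rwa [Real.norm_of_nonneg (sub_nonneg.2 hvw)] at this
  · have hy0 : 0 < y := hv.trans_le hy.1
    have h1 : ‖f' y‖ ≤ C * ‖y ^ K‖ := hsub ⟨hy0, hy.2.trans_lt hw⟩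
    rw [Real.norm_of_nonneg (by positivity)] at h1
    refine h1.trans ?_
    have h2 : y ^ K ≤ w ^ K := pow_le_pow_left₀ hy0.le hy.2 K
    exact mul_le_mul (le_abs_self C) h2 (by positivity) (abs_nonneg C)

lemma isBigO_pow_succ_of_hasDerivAt {f f' : ℝ → ℂ} (hf : ∀ u > 0, HasDerivAt f (f' u) u)
    {K : ℕ} (hf' : f' =O[𝓝[>] 0] fun u : ℝ => u ^ K) (h0 : Tendsto f (𝓝[>] 0) (𝓝 0)) :
    f =O[𝓝[>] 0] fun u : ℝ => u ^ (K + 1) := by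
  obtain ⟨C, δ, hδ, h⟩ := exists_norm_sub_le_of_isBigO_pow hf hf'
  refine IsBigO.of_bound C ?_
  filter_upwards [Ioo_mem_nhdsGT hδ] with w hw
  have h1 : Tendsto (fun v => ‖f w - f v‖) (𝓝[>] 0) (𝓝 ‖f w - 0‖) :=
    (tendsto_const_nhds.sub h0).norm
  have h2 : Tendsto (fun v : ℝ => C * w ^ K * (w - v)) (𝓝[>] 0) (𝓝 (C * w ^ K * (w - 0))) :=
    (tendsto_const_nhds.mul (tendsto_const_nhds.sub tendsto_id)).mono_left nhdsWithin_le_nhds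
  have h3 := le_of_tendsto_of_tendsto h1 h2 (by
    filter_upwards [Ioo_mem_nhdsGT hw.1] with v hv
    exact h v w hv.1 hv.2.le hw.2)
  rw [sub_zero, sub_zero] at h3
  rw [Real.norm_of_nonneg (pow_nonneg hw.1.le _), pow_succ, ← mul_assoc]
  exact h3

lemma exists_tendsto_of_hasDerivAt_isBigO_one {f f' : ℝ → ℂ}
    (hf : ∀ u > 0, HasDerivAt f (f' u) u)
    (hf' : f' =O[𝓝[>] 0] fun _ : ℝ => (1 : ℝ)) : ∃ C, Tendsto f (𝓝[>] 0) (𝓝 C) := by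
  obtain ⟨C, δ, hδ, h⟩ := exists_norm_sub_le_of_isBigO_pow (K := 0) hf (by simpa using hf')
  have hlip : LipschitzOnWith (Real.toNNReal C) f (Set.Ioo 0 δ) := by
    refine LipschitzOnWith.of_dist_le_mul fun v hv w hw => ?_
    have hC : C ≤ (Real.toNNReal C : ℝ) := Real.le_coe_toNNReal C
    rw [dist_eq_norm, dist_eq_norm]
    rcases le_total v w with hvw | hvw
    · have := h v w hv.1 hvw hw.2
      rw [norm_sub_rev, norm_sub_rev v w, Real.norm_of_nonneg (sub_nonneg.2 hvw)]
      refine this.trans ?_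
      rw [pow_zero, mul_one]
      exact mul_le_mul_of_nonneg_right hC (sub_nonneg.2 hvw)
    · have := h w v hw.1 hvw hv.2
      rw [Real.norm_of_nonneg (sub_nonneg.2 hvw)]
      refine this.trans ?_
      rw [pow_zero, mul_one]
      exact mul_le_mul_of_nonneg_right hC (sub_nonneg.2 hvw)
  have hcau : Cauchy (𝓝[>] (0 : ℝ)) := cauchy_nhds.mono nhdsWithin_le_nhds
  exact cauchy_map_iff_exists_tendsto.1
    (hcau.map_of_le hlip.uniformContinuousOn (le_principal_iff.2 (Ioo_mem_nhdsGT hδ)))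

/-! ### The zeta function near its pole -/

lemma meromorphic_riemannZeta : Meromorphic riemannZeta := by
  intro s
  by_cases hs : s = 1
  · subst hs
    have h1 : AnalyticAt ℂ (Function.update (fun s => (s - 1) * riemannZeta s) 1 1) 1 := by
      refine Complex.analyticAt_of_differentiable_on_punctured_nhds_of_continuousAt ?_ ?_
      · filter_upwards [self_mem_nhdsWithin] with s hs
        have h2 : DifferentiableAt ℂ (fun s => (s - 1) * riemannZeta s) s :=
          (differentiableAt_id.sub_const 1).mul (differentiableAt_riemannZeta hs)
        refine h2.congr_of_eventuallyEq ?_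
        filter_upwards [isOpen_compl_singleton.mem_nhds hs] with z hz
        exact Function.update_of_ne hz _ _
      · exact continuousAt_update_same.2 riemannZeta_residue_one
    have h2 : MeromorphicAt (fun s : ℂ => (s - 1)⁻¹) 1 := by fun_prop
    refine (h2.mul h1.meromorphicAt).congr ?_
    filter_upwards [self_mem_nhdsWithin] with s hs
    have hs' : s - 1 ≠ 0 := sub_ne_zero.2 hs
    rw [Pi.mul_apply, Function.update_of_ne hs, inv_mul_cancel_left₀ hs']
  · have : DifferentiableOn ℂ riemannZeta {1}ᶜ := fun z hz =>
      (differentiableAt_riemannZeta hz).differentiableWithinAt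
    exact (this.analyticAt (isOpen_compl_singleton.mem_nhds hs)).meromorphicAt

/-- The Riemann zeta function with value `0` at `1`. The value `0` is the constant term of
`Li_1(e^{-u}) + log u` at `u = 0`, and it makes the undefined terms of the expansions drop out.
Mathlib's `riemannZeta 1` is not `0`. -/
def zetaFinitePart (z : ℂ) : ℂ := if z = 1 then 0 else riemannZeta z

/-! ### The singular part of the expansion -/

open Classical in
/-- The singular part of the expansion of `Li_s(e^{-xu})` as `u → 0⁺`. It is
`Γ(1 - s) (xu) ^ (s - 1)`, unless `s = n + 1` with `n : ℕ`, where `Γ(1 - s)` has a pole and the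
singular part is `(-xu) ^ n / n! * (H_n - log (xu))`. -/
def polylogSing (s : ℂ) (x : ℝ) : LogPowerSum :=
  if h : ∃ n : ℕ, s = n + 1 then
    AddMonoidAlgebra.single ((h.choose : ℂ), 0)
      ((-(x : ℂ)) ^ h.choose / (h.choose ! : ℂ) * (harmonicC h.choose - Real.log x)) +
    AddMonoidAlgebra.single ((h.choose : ℂ), 1) (-((-(x : ℂ)) ^ h.choose / (h.choose ! : ℂ)))
  else AddMonoidAlgebra.single (s - 1, 0) (Complex.Gamma (1 - s) * (x : ℂ) ^ (s - 1))

lemma polylogSing_natCast_add_one (n : ℕ) (x : ℝ) : polylogSing (n + 1) x =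
    AddMonoidAlgebra.single ((n : ℂ), 0)
      ((-(x : ℂ)) ^ n / (n ! : ℂ) * (harmonicC n - Real.log x)) +
    AddMonoidAlgebra.single ((n : ℂ), 1) (-((-(x : ℂ)) ^ n / (n ! : ℂ))) := by
  have h : ∃ m : ℕ, (n : ℂ) + 1 = m + 1 := ⟨n, rfl⟩
  have hn : h.choose = n := by
    have := h.choose_spec
    exact_mod_cast (add_right_cancel this).symm
  rw [polylogSing, dif_pos h, hn]

lemma polylogSing_of_ne {s : ℂ} (hs : ∀ n : ℕ, s ≠ n + 1) (x : ℝ) : polylogSing s x =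
    AddMonoidAlgebra.single (s - 1, 0) (Complex.Gamma (1 - s) * (x : ℂ) ^ (s - 1)) := by
  rw [polylogSing, dif_neg (by simpa using hs)]

lemma eval_polylogSing_natCast_add_one (n : ℕ) (u : ℝ) :
    (polylogSing (n + 1) 1).eval u =
      (-(u : ℂ)) ^ n / (n ! : ℂ) * (harmonicC n - Real.log u) := by
  rw [polylogSing_natCast_add_one, LogPowerSum.eval_add, LogPowerSum.eval_single,
    LogPowerSum.eval_single, neg_pow (u : ℂ)]
  simp only [Complex.cpow_natCast, Complex.ofReal_one, Real.log_one, Complex.ofReal_zero]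
  ring

lemma eval_polylogSing_of_ne {s : ℂ} (hs : ∀ n : ℕ, s ≠ n + 1) (u : ℝ) :
    (polylogSing s 1).eval u = Complex.Gamma (1 - s) * (u : ℂ) ^ (s - 1) := by
  rw [polylogSing_of_ne hs, LogPowerSum.eval_single]
  simp

lemma eval_polylogSing_mul (s : ℂ) {x u : ℝ} (hx : 0 < x) (hu : 0 < u) :
    (polylogSing s x).eval u = (polylogSing s 1).eval (x * u) := by
  by_cases h : ∃ n : ℕ, s = n + 1
  · obtain ⟨n, rfl⟩ := h
    rw [eval_polylogSing_natCast_add_one, polylogSing_natCast_add_one, LogPowerSum.eval_add,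
      LogPowerSum.eval_single, LogPowerSum.eval_single, Real.log_mul hx.ne' hu.ne']
    simp only [Complex.cpow_natCast]
    push_cast
    rw [neg_mul_eq_neg_mul, mul_pow]
    ring
  · push Not at h
    rw [eval_polylogSing_of_ne h, polylogSing_of_ne h, LogPowerSum.eval_single, Complex.ofReal_mul,
      Complex.mul_cpow_ofReal_nonneg hx.le hu.le]
    simp only [pow_zero]
    ring

/-- The singular part obeys the differential equation of the polylogarithm. -/
lemma hasDerivAt_eval_polylogSing (s : ℂ) {u : ℝ} (hu : 0 < u) :
    HasDerivAt (fun u => (polylogSing s 1).eval u) (-(polylogSing (s - 1) 1).eval u) u := by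
  have hu0 : (u : ℂ) ≠ 0 := by exact_mod_cast hu.ne'
  by_cases h : ∃ n : ℕ, s = n + 1
  · obtain ⟨n, rfl⟩ := h
    simp only [eval_polylogSing_natCast_add_one]
    have h1 : HasDerivAt (fun u : ℝ => ((Real.log u : ℝ) : ℂ)) (((u⁻¹ : ℝ) : ℂ)) u :=
      (Real.hasDerivAt_log hu.ne').ofReal_comp
    have h2 : HasDerivAt (fun u : ℝ => (-(u : ℂ)) ^ n / (n ! : ℂ))
        ((n : ℂ) * (-(u : ℂ)) ^ (n - 1) * (-1) / (n ! : ℂ)) u := by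
      have h3 : HasDerivAt (fun u : ℝ => -(u : ℂ)) (-1) u := by
        simpa using ((hasDerivAt_id u).ofReal_comp).fun_neg
      exact (h3.fun_pow n).div_const _
    have h4 := h2.mul (h1.const_sub (harmonicC n))
    refine h4.congr_deriv ?_
    rw [add_sub_cancel_right]
    rcases n with _ | n
    · have : ∀ n : ℕ, (((0 : ℕ) : ℂ)) ≠ n + 1 := by
        intro n; rw [Nat.cast_zero]; exact (Nat.cast_add_one_ne_zero n).symm
      rw [eval_polylogSing_of_ne this]
      simp [Complex.cpow_neg_one]
    · push_cast
      rw [eval_polylogSing_natCast_add_one, Nat.factorial_succ, harmonicC, harmonicC,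
        harmonic_succ, pow_succ]
      have : (n ! : ℂ) ≠ 0 := by exact_mod_cast n.factorial_ne_zero
      have h5 : (n : ℂ) + 1 ≠ 0 := Nat.cast_add_one_ne_zero n
      push_cast
      field_simp
      ring
  · push Not at h
    have h' : ∀ n : ℕ, s - 1 ≠ n + 1 := fun n hn => h (n + 1) (by
      push_cast; linear_combination hn)
    simp only [eval_polylogSing_of_ne h, eval_polylogSing_of_ne h']
    have hs1 : s - 1 ≠ 0 := fun h0 => h 0 (by push_cast; linear_combination h0)
    have h1 := (hasDerivAt_ofReal_cpow_const hu.ne' hs1).const_mul (Complex.Gamma (1 - s))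
    refine h1.congr_deriv ?_
    have h2 : Complex.Gamma (1 - (s - 1)) = (1 - s) * Complex.Gamma (1 - s) := by
      rw [← Complex.Gamma_add_one _ (fun h0 => hs1 (by linear_combination -h0))]
      congr 1
      ring
    rw [h2]
    ring

/-! ### The constant term as a residue -/

lemma mellin_polylogExp {s t : ℂ} (ht : 0 < t.re) (hst : 1 < (s + t).re) :
    mellin (polylogExp s) t = Complex.Gamma t * riemannZeta (s + t) := by
  have hterm : ∀ m : ℕ, 1 / ((m : ℂ) + 1) ^ (s + t) =
      ((m + 1 : ℕ) : ℂ) ^ (-s) / (((m + 1 : ℕ) : ℝ) : ℂ) ^ t := by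
    intro m
    have : ((m + 1 : ℕ) : ℂ) ≠ 0 := Nat.cast_ne_zero.2 m.succ_ne_zero
    rw [Complex.cpow_neg]
    push_cast at this ⊢
    rw [Complex.cpow_add _ _ this]
    field_simp
  have hnorm : ∀ m : ℕ, ‖1 / ((m : ℂ) + 1) ^ (s + t)‖ =
      ‖((m + 1 : ℕ) : ℂ) ^ (-s)‖ / ((m + 1 : ℕ) : ℝ) ^ t.re := by
    intro m
    rw [hterm, norm_div, Complex.ofReal_natCast, Complex.norm_natCast_cpow_of_pos m.succ_pos t]
  have hsum : Summable fun m : ℕ => 1 / ((m : ℂ) + 1) ^ (s + t) := by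
    have := (summable_nat_add_iff 1).2 (Complex.summable_one_div_nat_cpow.2 hst)
    simpa using this
  have h := hasSum_mellin (a := fun m : ℕ => ((m + 1 : ℕ) : ℂ) ^ (-s))
    (p := fun m : ℕ => ((m + 1 : ℕ) : ℝ)) (F := polylogExp s) (s := t)
    (fun m => Or.inr (by positivity)) ht (fun u hu => hasSum_polylogExp s hu)
    (by simpa only [hnorm] using hsum.norm)
  rw [zeta_eq_tsum_one_div_nat_add_one_cpow hst, ← tsum_mul_left, ← h.tsum_eq]
  refine tsum_congr fun m => ?_
  rw [hterm, mul_div_assoc]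

/-- The constant term `C` of the expansion exists by integration. It is the residue at `t = 0` of
the Mellin transform, which is also `Γ(t) ζ(s + t)`. -/
lemma tendsto_polylogExp_sub_of_isBigO {s : ℂ} (hs : ∀ n : ℕ, s ≠ n + 1)
    (hO : (fun u : ℝ => polylogExp (s - 1) u - (polylogSing (s - 1) 1).eval u) =O[𝓝[>] 0]
      fun _ : ℝ => (1 : ℝ)) :
    Tendsto (fun u : ℝ => polylogExp s u - (polylogSing s 1).eval u) (𝓝[>] 0)
      (𝓝 (riemannZeta s)) := by
  have hs1 : s ≠ 1 := by simpa using hs 0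
  have hder : ∀ u > 0, HasDerivAt (fun u => polylogExp s u - (polylogSing s 1).eval u)
      (-(polylogExp (s - 1) u - (polylogSing (s - 1) 1).eval u)) u := by
    intro u hu
    refine ((hasDerivAt_polylogExp s hu).sub (hasDerivAt_eval_polylogSing s hu)).congr_deriv ?_
    ring
  obtain ⟨C, hC⟩ := exists_tendsto_of_hasDerivAt_isBigO_one hder hO.neg_left
  suffices C = riemannZeta s by rwa [← this]
  set p : LogPowerSum := polylogSing s 1 + AddMonoidAlgebra.single (0, 0) C with hp
  have hexp : (fun u => polylogExp s u - p.eval u) =O[𝓝[>] 0] fun u : ℝ => u ^ (1 : ℝ) := by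
    have h1 : ∀ u > 0, HasDerivAt (fun u => polylogExp s u - p.eval u)
        (-(polylogExp (s - 1) u - (polylogSing (s - 1) 1).eval u)) u := by
      intro u hu
      refine ((hder u hu).sub_const C).congr_of_eventuallyEq (Eventually.of_forall fun v => ?_)
      simp only [hp, LogPowerSum.eval_add, LogPowerSum.eval_single]
      simp
      ring
    have h2 : Tendsto (fun u => polylogExp s u - p.eval u) (𝓝[>] 0) (𝓝 0) := by
      rw [← sub_self C]
      refine (hC.sub_const C).congr fun v => ?_
      simp only [hp, LogPowerSum.eval_add, LogPowerSum.eval_single]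
      simp
      ring
    simpa using isBigO_pow_succ_of_hasDerivAt (K := 0) h1 (by simpa using hO.neg_left) h2
  obtain ⟨h, hh, T, hT⟩ := exists_mellin_eq_polar_add (continuousOn_polylogExp s)
    (polylogExp_isBigO_rpow_atTop s) hexp
  set U : Set ℂ := {t | -1 < t.re} with hU
  have hUo : IsOpen U := isOpen_lt continuous_const Complex.continuous_re
  have hm1 : MeromorphicOn (fun t => p.polar t + h t) U := fun t ht =>
    (p.polar_meromorphicAt t).add (hh.analyticAt (hUo.mem_nhds ht)).meromorphicAt
  have hm2 : MeromorphicOn (fun t => Complex.Gamma t * riemannZeta (s + t)) U := fun t _ => by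
    refine MeromorphicAt.mul (Meromorphic.Gamma t) ?_
    have h1 : AnalyticAt ℂ (fun t => s + t) t := by fun_prop
    refine (meromorphic_riemannZeta (s + t)).comp_analyticAt h1
  set T' : ℝ := max (max T 0) (1 - s.re) with hT'
  -- the two expressions for the Mellin transform agree on a half-plane, hence near `0`
  have hev : (fun t => p.polar t + h t) =ᶠ[𝓝[≠] ((T' + 1 : ℝ) : ℂ)]
      fun t => Complex.Gamma t * riemannZeta (s + t) := by
    have : {t : ℂ | T' < t.re} ∈ 𝓝 ((T' + 1 : ℝ) : ℂ) :=
      (isOpen_lt continuous_const Complex.continuous_re).mem_nhds (by simp)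
    filter_upwards [mem_nhdsWithin_of_mem_nhds this] with t ht
    have ht' : T' < t.re := ht
    have h1 : T ≤ T' := (le_max_left _ _).trans (le_max_left _ _)
    have h2 : 0 ≤ T' := (le_max_right _ _).trans (le_max_left _ _)
    have h3 : 1 - s.re ≤ T' := le_max_right _ _
    rw [← hT t (h1.trans_lt ht'), mellin_polylogExp (h2.trans_lt ht')]
    rw [Complex.add_re]
    linarith
  have hT0 : 0 ≤ T' := (le_max_right _ _).trans (le_max_left _ _)
  have hev0 := hm1.eventuallyEq_nhdsNE_of_isPreconnected hm2
    (convex_halfSpace_re_gt (-1)).isPreconnected (z := 0) (by simp [hU]; linarith) (by simp [hU]) hev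
  have hlim1 : Tendsto (fun t => t * (p.polar t + h t)) (𝓝[≠] 0) (𝓝 C) := by
    have hc : ContinuousAt (fun t => t * (Complex.Gamma (1 - s) / (t + (s - 1))) + C + t * h t) 0 := by
      have h1 : ContinuousAt h 0 := (hh.analyticAt (hUo.mem_nhds (by simp [hU]))).continuousAt
      have h2 : (0 : ℂ) + (s - 1) ≠ 0 := by rw [zero_add]; exact sub_ne_zero.2 hs1
      fun_prop (disch := assumption)
    have h3 := (hc.tendsto).mono_left (nhdsWithin_le_nhds (s := {0}ᶜ))
    simp only [zero_mul, zero_add, add_zero] at h3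
    refine h3.congr' ?_
    filter_upwards [self_mem_nhdsWithin] with t ht
    have ht0 : t ≠ 0 := ht
    rw [hp, LogPowerSum.polar_add, polylogSing_of_ne hs, LogPowerSum.polar_single,
      LogPowerSum.polar_single]
    simp only [Complex.ofReal_one, Complex.one_cpow]
    have h4 : C = t * (C / t) := by field_simp
    simp only [pow_zero, Nat.factorial_zero, Nat.cast_one, zero_add, pow_one, one_mul, add_zero,
      mul_one_div]
    linear_combination h4
  have hlim2 : Tendsto (fun t => t * (Complex.Gamma t * riemannZeta (s + t))) (𝓝[≠] 0)
      (𝓝 (riemannZeta s)) := by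
    have hc : ContinuousAt (fun t => Complex.Gamma (t + 1) * riemannZeta (s + t)) 0 := by
      refine ContinuousAt.mul ?_ ?_
      · refine ContinuousAt.comp (f := fun t : ℂ => t + 1) (g := Complex.Gamma) ?_ (by fun_prop)
        simp only [zero_add]
        exact Complex.hasDerivAt_Gamma_one.continuousAt
      · refine ContinuousAt.comp (f := fun t : ℂ => s + t) (g := riemannZeta) ?_ (by fun_prop)
        simp only [add_zero]
        exact (differentiableAt_riemannZeta hs1).continuousAt
    have h3 := (hc.tendsto).mono_left (nhdsWithin_le_nhds (s := {0}ᶜ))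
    simp only [zero_add, add_zero, Complex.Gamma_one, one_mul] at h3
    refine h3.congr' ?_
    filter_upwards [self_mem_nhdsWithin] with t ht
    rw [Complex.Gamma_add_one _ ht]
    ring
  refine tendsto_nhds_unique hlim1 (hlim2.congr' ?_)
  filter_upwards [hev0] with t ht
  rw [ht]

/-! ### The expansion of the polylogarithm at zero -/

/-- The order `s` is raised by steps of `1` from the half-plane `Re s < 0`. -/
lemma polylogExp_sub_isBigO_of_ne {s : ℂ} (hs : ∀ n : ℕ, s ≠ n + 1) :
    (fun u : ℝ => polylogExp s u - (polylogSing s 1).eval u) =O[𝓝[>] 0]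
      fun _ : ℝ => (1 : ℝ) := by
  obtain ⟨n, hn⟩ := exists_nat_gt s.re
  induction n generalizing s with
  | zero =>
    simp only [eval_polylogSing_of_ne hs]
    exact polylogExp_sub_isBigO_one (by simpa using hn)
  | succ n ih =>
    have hs' : ∀ n : ℕ, s - 1 ≠ n + 1 := fun n hn => hs (n + 1) (by
      push_cast; linear_combination hn)
    have h := ih hs' (by push_cast at hn; simp; linarith)
    exact (tendsto_polylogExp_sub_of_isBigO hs h).isBigO_one ℝ

lemma tendsto_polylogExp_of_one_lt_re {s : ℂ} (hs : 1 < s.re) :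
    Tendsto (polylogExp s) (𝓝[>] 0) (𝓝 (riemannZeta s)) := by
  have hsum : Summable fun m : ℕ => ((m + 1 : ℕ) : ℝ) ^ (-s.re) := by
    have := (summable_nat_add_iff 1).2 (Real.summable_nat_rpow.2 (neg_lt_neg hs))
    simpa using this
  rw [zeta_eq_tsum_one_div_nat_add_one_cpow hs]
  refine tendsto_tsum_of_dominated_convergence hsum (fun m => ?_) ?_
  · have h1 : ContinuousAt (fun u : ℝ => polylogTerm s m u) 0 := by
      unfold polylogTerm
      have : ContinuousAt (fun u : ℝ => Real.exp (-((m + 1 : ℕ) : ℝ) * u)) 0 := by fun_prop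
      exact continuousAt_const.mul (Complex.continuous_ofReal.continuousAt.comp this)
    have h2 := h1.tendsto.mono_left (nhdsWithin_le_nhds (s := Set.Ioi 0))
    have h3 : polylogTerm s m 0 = 1 / ((m : ℂ) + 1) ^ s := by
      simp [polylogTerm, Complex.cpow_neg]
    rwa [h3] at h2
  · filter_upwards [self_mem_nhdsWithin] with u hu m
    have hu' : 0 < u := hu
    rw [norm_polylogTerm]
    refine mul_le_of_le_one_right (by positivity) (Real.exp_le_one_iff.2 ?_)
    rw [neg_mul]
    exact neg_nonpos.2 (by positivity)

lemma polylogExp_one {u : ℝ} (hu : 0 < u) :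
    polylogExp 1 u = ((-Real.log (1 - Real.exp (-u)) : ℝ) : ℂ) := by
  have hlt : |Real.exp (-u)| < 1 := by
    rw [abs_of_pos (Real.exp_pos _)]
    exact Real.exp_lt_one_iff.2 (by linarith)
  have h := (Real.hasSum_pow_div_log_of_abs_lt_one hlt)
  rw [← (Complex.hasSum_ofReal.2 h).tsum_eq, polylogExp]
  refine tsum_congr fun m => ?_
  rw [polylogTerm, Complex.cpow_neg_one, ← Real.exp_nat_mul]
  push_cast
  rw [div_eq_inv_mul]
  congr 2
  ring

lemma LogPowerSum.tendsto_monomial {α : ℂ} (hα : 0 < α.re) (β : ℕ) :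
    Tendsto (fun u : ℝ => (u : ℂ) ^ α * (Real.log u : ℂ) ^ β) (𝓝[>] 0) (𝓝 0) := by
  refine (LogPowerSum.isBigO_monomial α β (b := -(α.re / 2)) (by linarith)).trans_tendsto ?_
  rw [neg_neg]
  have h := (Real.continuousAt_rpow_const 0 (α.re / 2) (Or.inr (by linarith))).tendsto
  rw [Real.zero_rpow (by linarith)] at h
  exact h.mono_left nhdsWithin_le_nhds

/-- The constant term of the expansion. -/
theorem tendsto_polylogExp_sub (s : ℂ) :
    Tendsto (fun u : ℝ => polylogExp s u - (polylogSing s 1).eval u) (𝓝[>] 0)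
      (𝓝 (zetaFinitePart s)) := by
  by_cases h : ∃ n : ℕ, s = n + 1
  · obtain ⟨n, rfl⟩ := h
    rcases n with _ | n
    · rw [zetaFinitePart, if_pos (by simp)]
      -- here `Li_1(e^{-u}) + log u = -log ((1 - e^{-u}) / u)`
      have h1 : Tendsto (fun u : ℝ => (Real.exp (-u) - 1) / (-u)) (𝓝[>] 0) (𝓝 1) := by
        have h2 := (Real.hasDerivAt_exp 0).tendsto_slope_zero
        have h3 : Tendsto (fun u : ℝ => -u) (𝓝[>] 0) (𝓝[≠] 0) := by
          refine tendsto_nhdsWithin_iff.2 ⟨?_, ?_⟩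
          · have := (continuous_neg (G := ℝ)).tendsto 0
            rw [neg_zero] at this
            exact this.mono_left nhdsWithin_le_nhds
          · filter_upwards [self_mem_nhdsWithin] with u hu
            exact neg_ne_zero.2 (ne_of_gt hu)
        have h4 := h2.comp h3
        rw [Real.exp_zero] at h4
        refine h4.congr fun u => ?_
        simp [div_eq_inv_mul]
      have h5 := ((Real.continuousAt_log one_ne_zero).tendsto.comp h1).neg
      rw [Real.log_one, neg_zero] at h5
      have h6 := (Complex.continuous_ofReal.tendsto 0).comp h5
      rw [Complex.ofReal_zero] at h6
      refine h6.congr' ?_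
      filter_upwards [self_mem_nhdsWithin] with u hu
      have hu' : 0 < u := hu
      have h7 : (Real.exp (-u) - 1) / (-u) = (1 - Real.exp (-u)) / u := by
        field_simp; ring
      have h8 : 1 - Real.exp (-u) ≠ 0 := by
        have := Real.exp_lt_one_iff.2 (show -u < 0 by linarith)
        linarith
      rw [eval_polylogSing_natCast_add_one]
      simp only [Function.comp_apply, h7]
      rw [Nat.cast_zero, zero_add, polylogExp_one hu', Real.log_div h8 hu'.ne']
      simp [harmonicC]
      ring
    · have hre : 1 < (((n + 1 : ℕ) : ℂ) + 1).re := by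
        push_cast
        simp only [Complex.add_re, Complex.natCast_re, Complex.one_re]
        linarith [Nat.cast_nonneg (α := ℝ) n]
      have hne : (((n + 1 : ℕ) : ℂ) + 1) ≠ 1 := by
        intro h; rw [h] at hre; simp at hre
      rw [zetaFinitePart, if_neg hne]
      have h1 : Tendsto (fun u => (polylogSing (((n + 1 : ℕ) : ℂ) + 1) 1).eval u)
          (𝓝[>] 0) (𝓝 0) := by
        have hre' : 0 < (((n + 1 : ℕ) : ℂ)).re := by
          rw [Complex.natCast_re]; positivity
        rw [polylogSing_natCast_add_one]
        simp only [LogPowerSum.eval_add, LogPowerSum.eval_single]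
        simpa only [mul_zero, add_zero] using
          ((LogPowerSum.tendsto_monomial hre' 0).const_mul _).add
            ((LogPowerSum.tendsto_monomial hre' 1).const_mul _)
      simpa using (tendsto_polylogExp_of_one_lt_re hre).sub h1
  · push Not at h
    have hs1 : s ≠ 1 := by simpa using h 0
    rw [zetaFinitePart, if_neg hs1]
    refine tendsto_polylogExp_sub_of_isBigO h (polylogExp_sub_isBigO_of_ne fun n hn => ?_)
    exact h (n + 1) (by push_cast; linear_combination hn)

/-- The expansion of `Li_s(e^{-xu})` as `u → 0⁺` up to `O(u ^ K)`: the singular part and the terms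
`ζ(s - k) (-xu) ^ k / k!` with `k < K`, the term with `s - k = 1` being absent. -/
def polylogExpansion (s : ℂ) (x : ℝ) (K : ℕ) : LogPowerSum :=
  polylogSing s x + ∑ k ∈ range K, AddMonoidAlgebra.single ((k : ℂ), 0)
    (zetaFinitePart (s - k) * (-(x : ℂ)) ^ k / (k ! : ℂ))

lemma eval_polylogExpansion_one (s : ℂ) (K : ℕ) (u : ℝ) :
    (polylogExpansion s 1 K).eval u = (polylogSing s 1).eval u +
      ∑ k ∈ range K, zetaFinitePart (s - k) * (-(u : ℂ)) ^ k / (k ! : ℂ) := by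
  rw [polylogExpansion, LogPowerSum.eval_add, LogPowerSum.eval_sum]
  congr 1
  refine Finset.sum_congr rfl fun k _ => ?_
  rw [LogPowerSum.eval_single, neg_pow (u : ℂ)]
  simp only [Complex.cpow_natCast, Complex.ofReal_one]
  ring

lemma eval_polylogExpansion_mul (s : ℂ) (K : ℕ) {x u : ℝ} (hx : 0 < x) (hu : 0 < u) :
    (polylogExpansion s x K).eval u = (polylogExpansion s 1 K).eval (x * u) := by
  rw [eval_polylogExpansion_one, polylogExpansion, LogPowerSum.eval_add, LogPowerSum.eval_sum,
    eval_polylogSing_mul s hx hu]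
  congr 1
  refine Finset.sum_congr rfl fun k _ => ?_
  rw [LogPowerSum.eval_single]
  simp only [Complex.cpow_natCast]
  push_cast
  rw [neg_mul_eq_neg_mul, mul_pow]
  ring

/-- Differentiation takes the expansion for `s` to that for `s - 1` with one term less. -/
lemma polylogExp_sub_expansion_one_isBigO (s : ℂ) (K : ℕ) :
    (fun u : ℝ => polylogExp s u - (polylogExpansion s 1 K).eval u) =O[𝓝[>] 0]
      fun u : ℝ => u ^ K := by
  induction K generalizing s with
  | zero =>
    simp only [eval_polylogExpansion_one, range_zero, sum_empty, add_zero, pow_zero]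
    exact (tendsto_polylogExp_sub s).isBigO_one ℝ
  | succ K ih =>
    refine isBigO_pow_succ_of_hasDerivAt
      (f' := fun u => -(polylogExp (s - 1) u - (polylogExpansion (s - 1) 1 K).eval u))
      (fun u hu => ?_) (ih (s - 1)).neg_left ?_
    · simp only [eval_polylogExpansion_one]
      have h1 : HasDerivAt (fun u : ℝ => ∑ k ∈ range (K + 1),
          zetaFinitePart (s - k) * (-(u : ℂ)) ^ k / (k ! : ℂ))
          (∑ k ∈ range (K + 1), zetaFinitePart (s - k) *
            ((k : ℂ) * (-(u : ℂ)) ^ (k - 1) * (-1)) / (k ! : ℂ)) u := by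
        refine HasDerivAt.fun_sum fun k _ => ?_
        have h3 : HasDerivAt (fun u : ℝ => -(u : ℂ)) (-1) u := by
          simpa using ((hasDerivAt_id u).ofReal_comp).fun_neg
        exact ((h3.fun_pow k).const_mul _).div_const _
      refine ((hasDerivAt_polylogExp s hu).sub
        ((hasDerivAt_eval_polylogSing s hu).add h1)).congr_deriv ?_
      rw [Finset.sum_range_succ']
      have h2 : ∑ k ∈ range K, zetaFinitePart (s - ((k + 1 : ℕ) : ℂ)) *
            (((k + 1 : ℕ) : ℂ) * (-(u : ℂ)) ^ (k + 1 - 1) * (-1)) / ((k + 1)! : ℂ) =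
          -∑ k ∈ range K, zetaFinitePart (s - 1 - k) * (-(u : ℂ)) ^ k / (k ! : ℂ) := by
        rw [← Finset.sum_neg_distrib]
        refine Finset.sum_congr rfl fun k _ => ?_
        have h4 : (k ! : ℂ) ≠ 0 := by exact_mod_cast k.factorial_ne_zero
        have h5 : (k : ℂ) + 1 ≠ 0 := Nat.cast_add_one_ne_zero k
        have h6 : s - ((k + 1 : ℕ) : ℂ) = s - 1 - k := by push_cast; ring
        rw [h6, Nat.factorial_succ, Nat.add_sub_cancel]
        push_cast
        field_simp
      rw [h2]
      simp
      ring
    · have h1 : Tendsto (fun u : ℝ => ∑ k ∈ range K,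
          zetaFinitePart (s - ((k + 1 : ℕ) : ℂ)) * (-(u : ℂ)) ^ (k + 1) / ((k + 1)! : ℂ))
          (𝓝[>] 0) (𝓝 0) := by
        have h2 : Continuous (fun u : ℝ => ∑ k ∈ range K,
          zetaFinitePart (s - ((k + 1 : ℕ) : ℂ)) * (-(u : ℂ)) ^ (k + 1) / ((k + 1)! : ℂ)) := by
          fun_prop
        have h3 := (h2.tendsto 0).mono_left (nhdsWithin_le_nhds (s := Set.Ioi 0))
        simpa using h3
      have h4 := ((tendsto_polylogExp_sub s).sub_const (zetaFinitePart s)).sub h1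
      rw [sub_self, sub_zero] at h4
      refine h4.congr fun u => ?_
      rw [eval_polylogExpansion_one, Finset.sum_range_succ']
      simp
      ring

theorem polylogExp_sub_expansion_isBigO (s : ℂ) {x : ℝ} (hx : 0 < x) (K : ℕ) :
    (fun u : ℝ => polylogExp s (x * u) - (polylogExpansion s x K).eval u) =O[𝓝[>] 0]
      fun u : ℝ => u ^ K := by
  have h1 : Tendsto (fun u : ℝ => x * u) (𝓝[>] 0) (𝓝[>] 0) := by
    refine tendsto_nhdsWithin_iff.2 ⟨?_, ?_⟩
    · have := (continuous_const_mul x).tendsto (0 : ℝ)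
      rw [mul_zero] at this
      exact this.mono_left nhdsWithin_le_nhds
    · filter_upwards [self_mem_nhdsWithin] with u hu
      exact mul_pos hx hu
  have h2 := (polylogExp_sub_expansion_one_isBigO s K).comp_tendsto h1
  have h3 : ((fun u : ℝ => u ^ K) ∘ fun u => x * u) =O[𝓝[>] 0] fun u : ℝ => u ^ K := by
    simp only [Function.comp_def, mul_pow]
    exact (isBigO_refl _ _).const_mul_left _
  refine (h2.trans h3).congr' ?_ EventuallyEq.rfl
  filter_upwards [self_mem_nhdsWithin] with u hu
  rw [eval_polylogExpansion_mul s K hx hu]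
  rfl

namespace LogPowerSum

lemma exists_isBigO_eval (p : LogPowerSum) :
    ∃ b : ℝ, 0 ≤ b ∧ (fun u => p.eval u) =O[𝓝[>] 0] fun u : ℝ => u ^ (-b) := by
  have mono : ∀ {b c : ℝ}, b ≤ c → (fun u : ℝ => u ^ (-b)) =O[𝓝[>] 0] fun u => u ^ (-c) := by
    intro b c hbc
    refine IsBigO.of_bound 1 ?_
    filter_upwards [Ioo_mem_nhdsGT (zero_lt_one (α := ℝ))] with u hu
    rw [Real.norm_of_nonneg (Real.rpow_nonneg hu.1.le _),
      Real.norm_of_nonneg (Real.rpow_nonneg hu.1.le _), one_mul]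
    exact Real.rpow_le_rpow_of_exponent_ge hu.1 hu.2.le (by linarith)
  induction p using AddMonoidAlgebra.induction_linear with
  | zero => exact ⟨0, le_rfl, by simpa only [eval_zero] using isBigO_zero _ _⟩
  | add p q hp hq =>
    obtain ⟨b, hb, h1⟩ := hp
    obtain ⟨c, hc, h2⟩ := hq
    refine ⟨max b c, le_max_of_le_left hb, ?_⟩
    simp only [eval_add]
    exact (h1.trans (mono (le_max_left _ _))).add (h2.trans (mono (le_max_right _ _)))
  | single a c =>
    refine ⟨|a.1.re| + 1, by positivity, ?_⟩
    simp only [eval_single]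
    exact (isBigO_monomial a.1 a.2 (by linarith [neg_le_abs a.1.re])).const_mul_left c

/-- The product of two asymptotic expansions is an asymptotic expansion of the product. -/
theorem isBigO_mul_sub_eval_mul {f g : ℝ → ℂ} {p q : ℕ → LogPowerSum}
    (hf : ∀ K, (fun u => f u - (p K).eval u) =O[𝓝[>] 0] fun u : ℝ => u ^ K)
    (hg : ∀ K, (fun u => g u - (q K).eval u) =O[𝓝[>] 0] fun u : ℝ => u ^ K) (M : ℝ) :
    ∃ K₀ : ℕ, ∀ K ≥ K₀,
      (fun u => f u * g u - (p K * q K).eval u) =O[𝓝[>] 0] fun u : ℝ => u ^ M := by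
  have growth : ∀ {f : ℝ → ℂ} {p : LogPowerSum},
      ((fun u => f u - p.eval u) =O[𝓝[>] 0] fun u : ℝ => u ^ 0) →
      ∃ b : ℝ, 0 ≤ b ∧ f =O[𝓝[>] 0] fun u : ℝ => u ^ (-b) := by
    intro f p hfp
    obtain ⟨b, hb, h1⟩ := p.exists_isBigO_eval
    refine ⟨b, hb, ?_⟩
    have h2 : (fun u : ℝ => u ^ 0) =O[𝓝[>] 0] fun u : ℝ => u ^ (-b) := by
      refine IsBigO.of_bound 1 ?_
      filter_upwards [Ioo_mem_nhdsGT (zero_lt_one (α := ℝ))] with u hu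
      rw [pow_zero, norm_one, one_mul, Real.norm_of_nonneg (Real.rpow_nonneg hu.1.le _)]
      exact Real.one_le_rpow_of_pos_of_le_one_of_nonpos hu.1 hu.2.le (by linarith)
    simpa using (hfp.trans h2).add h1
  obtain ⟨b, hb, hfb⟩ := growth (hf 0)
  obtain ⟨c, hc, hgc⟩ := growth (hg 0)
  refine ⟨⌈M + b + c⌉₊, fun K hK => ?_⟩
  have hK' : M + b + c ≤ K := (Nat.le_ceil _).trans (by exact_mod_cast hK)
  have hsmall : ∀ d : ℝ, d ≤ K - M → ∀ {h₁ h₂ : ℝ → ℂ},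
      (h₁ =O[𝓝[>] 0] fun u : ℝ => u ^ K) → (h₂ =O[𝓝[>] 0] fun u : ℝ => u ^ (-d)) →
      (fun u => h₁ u * h₂ u) =O[𝓝[>] 0] fun u : ℝ => u ^ M := by
    intro d hd h₁ h₂ hh₁ hh₂
    refine (hh₁.mul hh₂).trans (IsBigO.of_bound 1 ?_)
    filter_upwards [Ioo_mem_nhdsGT (zero_lt_one (α := ℝ))] with u hu
    rw [← Real.rpow_natCast, ← Real.rpow_add hu.1, one_mul,
      Real.norm_of_nonneg (Real.rpow_nonneg hu.1.le _),
      Real.norm_of_nonneg (Real.rpow_nonneg hu.1.le _)]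
    exact Real.rpow_le_rpow_of_exponent_ge hu.1 hu.2.le (by linarith)
  have hpb : (fun u => (p K).eval u) =O[𝓝[>] 0] fun u : ℝ => u ^ (-b) := by
    have h2 : (fun u : ℝ => u ^ K) =O[𝓝[>] 0] fun u : ℝ => u ^ (-b) := by
      refine IsBigO.of_bound 1 ?_
      filter_upwards [Ioo_mem_nhdsGT (zero_lt_one (α := ℝ))] with u hu
      rw [← Real.rpow_natCast, one_mul,
        Real.norm_of_nonneg (Real.rpow_nonneg hu.1.le _),
        Real.norm_of_nonneg (Real.rpow_nonneg hu.1.le _)]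
      exact Real.rpow_le_rpow_of_exponent_ge hu.1 hu.2.le
        (by linarith [Nat.cast_nonneg (α := ℝ) K])
    simpa using hfb.sub ((hf K).trans h2)
  refine ((hsmall c (by linarith) (hf K) hgc).add
    (hsmall b (by linarith) (hg K) hpb)).congr' ?_ EventuallyEq.rfl
  filter_upwards [self_mem_nhdsWithin] with u hu
  rw [eval_mul hu]
  ring

end LogPowerSum

/-! ### The double series and its integral representation -/

lemma norm_thetaTerm (r s t : ℂ) {x : ℝ} (hx : 0 < x) (p : ℕ × ℕ) : ‖thetaTerm r s t x p‖ =
    ((p.1 + 1 : ℕ) : ℝ) ^ (-r.re) * ((p.2 + 1 : ℕ) : ℝ) ^ (-s.re) *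
      ((p.1 + 1 : ℕ) + (p.2 + 1 : ℕ) * x : ℝ) ^ (-t.re) := by
  have h : (0 : ℝ) < (p.1 + 1 : ℕ) + (p.2 + 1 : ℕ) * x := by positivity
  rw [thetaTerm, norm_div, norm_mul, norm_mul, norm_one, Complex.norm_natCast_cpow_of_pos
    p.1.succ_pos, Complex.norm_natCast_cpow_of_pos p.2.succ_pos,
    Complex.norm_cpow_eq_rpow_re_of_pos h, Real.rpow_neg (by positivity),
    Real.rpow_neg (by positivity), Real.rpow_neg h.le, one_div, mul_inv, mul_inv]

lemma summable_succ_rpow {a : ℝ} (ha : 1 < a) :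
    Summable fun n : ℕ => ((n + 1 : ℕ) : ℝ) ^ (-a) :=
  (summable_nat_add_iff 1).2 (Real.summable_nat_rpow.2 (neg_lt_neg ha))

/-- If `Re t ≥ 0`, the factor `(n + m x) ^ (-t)` is split into powers of `n` and `m x` that leave
both exponents above `1`. If `Re t < 0`, it is at most a constant times `n ^ (-t) + (m x) ^ (-t)`
in norm. -/
lemma summable_norm_thetaTerm {r s t : ℂ} {x : ℝ} (hx : 0 < x) (hr : 1 ≤ r.re)
    (ht : thetaRegion r s t) : Summable fun p => ‖thetaTerm r s t x p‖ := by
  obtain ⟨h1, h2, -⟩ := ht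
  simp only [Complex.add_re] at h1 h2
  have hprod : ∀ {a b : ℝ}, 1 < a → 1 < b →
      Summable fun p : ℕ × ℕ => ((p.1 + 1 : ℕ) : ℝ) ^ (-a) * ((p.2 + 1 : ℕ) : ℝ) ^ (-b) :=
    fun ha hb => (summable_succ_rpow ha).mul_of_nonneg (summable_succ_rpow hb)
      (fun _ => by positivity) (fun _ => by positivity)
  rcases le_total 0 t.re with h0 | h0
  -- `u` is the part of the exponent that is given to `n`
  · set u := min t.re ((s.re + t.re - 1) / 2) with hu
    have hu0 : 0 ≤ u := le_min h0 (by linarith)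
    have hut : u ≤ t.re := min_le_left _ _
    have hus : u ≤ (s.re + t.re - 1) / 2 := min_le_right _ _
    have hru : 1 < r.re + u := by
      rcases h0.eq_or_lt with h | h
      · linarith
      · have : 0 < u := lt_min h (by linarith)
        linarith
    refine Summable.of_nonneg_of_le (fun _ => norm_nonneg _) (fun p => ?_)
      ((hprod hru (show 1 < s.re + (t.re - u) by linarith)).mul_left (x ^ (-(t.re - u))))
    have hn : (0 : ℝ) < ((p.1 + 1 : ℕ) : ℝ) := by positivity
    have hm : (0 : ℝ) < ((p.2 + 1 : ℕ) : ℝ) := by positivity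
    rw [norm_thetaTerm _ _ _ hx]
    set n : ℝ := ((p.1 + 1 : ℕ) : ℝ)
    set m : ℝ := ((p.2 + 1 : ℕ) : ℝ)
    have hb1 : (n + m * x) ^ (-u) ≤ n ^ (-u) :=
      Real.rpow_le_rpow_of_nonpos hn (by nlinarith [mul_pos hm hx]) (by linarith)
    have hb2 : (n + m * x) ^ (-(t.re - u)) ≤ (m * x) ^ (-(t.re - u)) :=
      Real.rpow_le_rpow_of_nonpos (mul_pos hm hx) (by linarith) (by linarith)
    have hb3 : (n + m * x) ^ (-t.re) ≤ n ^ (-u) * (m * x) ^ (-(t.re - u)) := by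
      have : -t.re = -u + -(t.re - u) := by ring
      rw [this, Real.rpow_add (by positivity)]
      exact mul_le_mul hb1 hb2 (by positivity) (by positivity)
    refine (mul_le_mul_of_nonneg_left hb3 (by positivity)).trans (le_of_eq ?_)
    rw [Real.mul_rpow hm.le hx.le, neg_add, Real.rpow_add hn, neg_add, Real.rpow_add hm]
    ring
  · set C : ℝ := 2 ^ (-t.re)
    have hs := ((hprod (show 1 < r.re + t.re by linarith) (show 1 < s.re by linarith)).add
      ((hprod (show 1 < r.re by linarith) (show 1 < s.re + t.re by linarith)).mul_left
        (x ^ (-t.re)))).mul_left C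
    refine Summable.of_nonneg_of_le (fun _ => norm_nonneg _) (fun p => ?_) hs
    have hn : (0 : ℝ) < ((p.1 + 1 : ℕ) : ℝ) := by positivity
    have hm : (0 : ℝ) < ((p.2 + 1 : ℕ) : ℝ) := by positivity
    rw [norm_thetaTerm _ _ _ hx]
    set n : ℝ := ((p.1 + 1 : ℕ) : ℝ)
    set m : ℝ := ((p.2 + 1 : ℕ) : ℝ)
    have hmx : 0 < m * x := mul_pos hm hx
    have ht0 : 0 ≤ -t.re := by linarith
    have hb : (n + m * x) ^ (-t.re) ≤ C * (n ^ (-t.re) + (m * x) ^ (-t.re)) := by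
      have hb1 : n + m * x ≤ 2 * max n (m * x) := by
        linarith [le_max_left n (m * x), le_max_right n (m * x)]
      refine (Real.rpow_le_rpow (by positivity) hb1 ht0).trans ?_
      rw [Real.mul_rpow (by norm_num) (by positivity)]
      refine mul_le_mul_of_nonneg_left ?_ (by positivity)
      rcases max_cases n (m * x) with h | h
      · rw [h.1]; exact le_add_of_nonneg_right (by positivity)
      · rw [h.1]; exact le_add_of_nonneg_left (by positivity)
    refine (mul_le_mul_of_nonneg_left hb (by positivity)).trans (le_of_eq ?_)
    rw [Real.mul_rpow hm.le hx.le, neg_add, Real.rpow_add hn, neg_add, Real.rpow_add hm]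
    ring

/-- The sum of the double series as a function of `t`. -/
def thetaSum (r s : ℂ) (x : ℝ) (t : ℂ) : ℂ := ∑' p, thetaTerm r s t x p

lemma hasSum_thetaSum {r s t : ℂ} {x : ℝ} (hx : 0 < x) (hr : 1 ≤ r.re)
    (ht : thetaRegion r s t) : HasSum (thetaTerm r s t x) (thetaSum r s x t) :=
  (summable_norm_thetaTerm hx hr ht).of_norm.hasSum

/-- For fixed `r` and `s` the region of convergence is a half-plane in `t`. -/
lemma thetaRegion_iff (r s t : ℂ) :
    thetaRegion r s t ↔ max (max (1 - r.re) (1 - s.re)) (2 - r.re - s.re) < t.re := by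
  simp only [thetaRegion, Complex.add_re, max_lt_iff]
  constructor
  · rintro ⟨h1, h2, h3⟩
    exact ⟨⟨by linarith, by linarith⟩, by linarith⟩
  · rintro ⟨⟨h1, h2⟩, h3⟩
    exact ⟨by linarith, by linarith, by linarith⟩

lemma isOpen_thetaRegion (r s : ℂ) : IsOpen {t | thetaRegion r s t} := by
  simp only [thetaRegion_iff]
  exact isOpen_lt continuous_const Complex.continuous_re

lemma differentiableOn_thetaSum {r s : ℂ} {x : ℝ} (hx : 0 < x) (hr : 1 ≤ r.re) :
    DifferentiableOn ℂ (thetaSum r s x) {t | thetaRegion r s t} := by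
  intro t ht
  have ht' := (thetaRegion_iff r s t).1 ht
  obtain ⟨τ, h1, h2⟩ := exists_between ht'
  have hτ : thetaRegion r s (τ : ℂ) := (thetaRegion_iff r s τ).2 (by simpa using h1)
  have hopen : IsOpen {t : ℂ | τ < t.re} := isOpen_lt continuous_const Complex.continuous_re
  have hd : DifferentiableOn ℂ (thetaSum r s x) {t : ℂ | τ < t.re} := by
    refine Complex.differentiableOn_tsum_of_summable_norm (summable_norm_thetaTerm hx hr hτ)
      (fun p => ?_) hopen (fun p w hw => ?_)
    · have hn : ((p.1 + 1 : ℕ) : ℂ) ≠ 0 := Nat.cast_ne_zero.2 p.1.succ_ne_zero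
      have hm : ((p.2 + 1 : ℕ) : ℂ) ≠ 0 := Nat.cast_ne_zero.2 p.2.succ_ne_zero
      have hpos : (0 : ℝ) < (p.1 + 1 : ℕ) + (p.2 + 1 : ℕ) * x := by positivity
      have hb : ((((p.1 + 1 : ℕ) : ℝ) + ((p.2 + 1 : ℕ) : ℝ) * x : ℝ) : ℂ) ≠ 0 := by
        exact_mod_cast hpos.ne'
      intro t _
      unfold thetaTerm
      refine DifferentiableAt.differentiableWithinAt ?_
      refine (differentiableAt_const _).div ((differentiableAt_const _).mul
        (DifferentiableAt.const_cpow differentiableAt_id (Or.inl hb))) ?_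
      exact mul_ne_zero (mul_ne_zero (Complex.cpow_ne_zero_iff.2 (Or.inl hn))
        (Complex.cpow_ne_zero_iff.2 (Or.inl hm))) (Complex.cpow_ne_zero_iff.2 (Or.inl hb))
    · have hw' : τ < w.re := hw
      rw [norm_thetaTerm _ _ _ hx, norm_thetaTerm _ _ _ hx, Complex.ofReal_re]
      refine mul_le_mul_of_nonneg_left ?_ (by positivity)
      refine Real.rpow_le_rpow_of_exponent_le ?_ (by linarith)
      have : (0 : ℝ) ≤ ((p.2 + 1 : ℕ) : ℝ) * x := by positivity
      push_cast at this ⊢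
      linarith [Nat.cast_nonneg (α := ℝ) p.1]
  exact (hd.differentiableAt (hopen.mem_nhds h2)).differentiableWithinAt

theorem mellin_polylogExp_mul {r s t : ℂ} {x : ℝ} (hx : 0 < x) (hr : 1 ≤ r.re)
    (ht0 : 0 < t.re) (ht : thetaRegion r s t) :
    mellin (fun u => polylogExp r u * polylogExp s (x * u)) t =
      Complex.Gamma t * thetaSum r s x t := by
  set a : ℕ × ℕ → ℂ := fun p => ((p.1 + 1 : ℕ) : ℂ) ^ (-r) * ((p.2 + 1 : ℕ) : ℂ) ^ (-s) with ha
  set q : ℕ × ℕ → ℝ := fun p => (p.1 + 1 : ℕ) + (p.2 + 1 : ℕ) * x with hq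
  have hq0 : ∀ p, 0 < q p := fun p => by simp only [hq]; positivity
  have hterm : ∀ p, thetaTerm r s t x p = a p / (q p : ℂ) ^ t := by
    intro p
    simp only [ha, hq, thetaTerm]
    rw [Complex.cpow_neg, Complex.cpow_neg, one_div, mul_inv, mul_inv, div_eq_mul_inv]
  have hF : ∀ u ∈ Set.Ioi (0 : ℝ), HasSum (fun p => a p * (Real.exp (-q p * u) : ℝ))
      (polylogExp r u * polylogExp s (x * u)) := by
    intro u hu
    have hu' : 0 < u := hu
    have hxu : 0 < x * u := mul_pos hx hu
    have hs : Summable fun p : ℕ × ℕ => polylogTerm r p.1 u * polylogTerm s p.2 (x * u) :=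
      summable_mul_of_summable_norm (f := fun m => polylogTerm r m u)
        (g := fun m => polylogTerm s m (x * u)) (summable_norm_polylogTerm r hu')
        (summable_norm_polylogTerm s hxu)
    have h1 : HasSum (fun p : ℕ × ℕ => polylogTerm r p.1 u * polylogTerm s p.2 (x * u))
        (polylogExp r u * polylogExp s (x * u)) := by
      rw [polylogExp, polylogExp, tsum_mul_tsum_of_summable_norm (summable_norm_polylogTerm r hu')
        (summable_norm_polylogTerm s hxu)]
      exact hs.hasSum
    refine h1.congr_fun (f := fun p : ℕ × ℕ => polylogTerm r p.1 u * polylogTerm s p.2 (x * u))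
      fun p => ?_
    simp only [ha, hq, polylogTerm]
    have : -(((p.1 + 1 : ℕ) : ℝ) + ((p.2 + 1 : ℕ) : ℝ) * x) * u =
      -((p.1 + 1 : ℕ) : ℝ) * u + -((p.2 + 1 : ℕ) : ℝ) * (x * u) := by ring
    rw [this, Real.exp_add, Complex.ofReal_mul]
    ring
  have hsum : Summable fun p => ‖a p‖ / q p ^ t.re := by
    refine (summable_norm_thetaTerm hx hr ht).congr fun p => ?_
    rw [hterm, norm_div, Complex.norm_cpow_eq_rpow_re_of_pos (hq0 p)]
  have h := hasSum_mellin (fun p => Or.inr (hq0 p)) ht0 hF hsum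
  rw [← h.tsum_eq, thetaSum, ← tsum_mul_left]
  refine tsum_congr fun p => ?_
  rw [hterm, mul_div_assoc]

/-! ### The meromorphic continuation -/

/-- The sum of the double series in terms of the expansions at zero, up to a function that is
holomorphic on `-M < Re t`. -/
theorem exists_thetaSum_eq {r s : ℂ} {x : ℝ} (hx : 0 < x) (hr : 1 ≤ r.re) (M : ℝ) :
    ∃ K₀ : ℕ, ∀ K ≥ K₀, ∃ h : ℂ → ℂ, DifferentiableOn ℂ h {t | -M < t.re} ∧
      ∃ T : ℝ, ∀ t : ℂ, T < t.re → thetaRegion r s t ∧ thetaSum r s x t = (Complex.Gamma t)⁻¹ *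
        ((polylogExpansion r 1 K * polylogExpansion s x K).polar t + h t) := by
  obtain ⟨K₀, hK₀⟩ := LogPowerSum.isBigO_mul_sub_eval_mul (f := polylogExp r)
    (g := fun u => polylogExp s (x * u))
    (fun K => by simpa using polylogExp_sub_expansion_isBigO r one_pos K)
    (polylogExp_sub_expansion_isBigO s hx) M
  refine ⟨K₀, fun K hK => ?_⟩
  have hcont : ContinuousOn (fun u => polylogExp r u * polylogExp s (x * u)) (Set.Ioi 0) := by
    refine (continuousOn_polylogExp r).mul ((continuousOn_polylogExp s).comp (by fun_prop) ?_)
    exact fun u hu => mul_pos hx hu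
  have htop : ∀ a : ℝ, (fun u => polylogExp r u * polylogExp s (x * u)) =O[atTop]
      fun u : ℝ => u ^ (-a) := by
    intro a
    have h1 := (polylogExp_isBigO_rpow_atTop s 0).comp_tendsto
      (tendsto_id.const_mul_atTop hx)
    have h2 := (polylogExp_isBigO_rpow_atTop r a).mul h1
    simpa [Function.comp_def] using h2
  obtain ⟨h, hh, T, hT⟩ := exists_mellin_eq_polar_add hcont htop (hK₀ K hK)
  set T₀ := max (max (1 - r.re) (1 - s.re)) (2 - r.re - s.re) with hT₀
  refine ⟨h, hh, max (max T 0) T₀, fun t ht => ?_⟩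
  have hreg : thetaRegion r s t := (thetaRegion_iff r s t).2 ((le_max_right _ _).trans_lt ht)
  have h0 : 0 < t.re := ((le_max_right _ _).trans (le_max_left _ _)).trans_lt ht
  have hT' : T < t.re := ((le_max_left _ _).trans (le_max_left _ _)).trans_lt ht
  refine ⟨hreg, ?_⟩
  rw [← hT t hT', mellin_polylogExp_mul hx hr h0 hreg,
    inv_mul_cancel_left₀ (Complex.Gamma_ne_zero_of_re_pos h0)]

lemma meromorphicOn_inv_Gamma_mul_polar_add (p : LogPowerSum) {h : ℂ → ℂ} {U : Set ℂ}
    (hU : IsOpen U) (hh : DifferentiableOn ℂ h U) :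
    MeromorphicOn (fun t => (Complex.Gamma t)⁻¹ * (p.polar t + h t)) U := fun t ht =>
  (Meromorphic.Gamma t).inv.mul
    ((p.polar_meromorphicAt t).add (hh.analyticAt (hU.mem_nhds ht)).meromorphicAt)

lemma MeromorphicNFOn.eqOn_of_isPreconnected {f g : ℂ → ℂ} {U : Set ℂ}
    (hf : MeromorphicNFOn f U) (hg : MeromorphicNFOn g U) (hU : IsPreconnected U) {z₀ : ℂ}
    (hz₀ : z₀ ∈ U) (h : f =ᶠ[𝓝[≠] z₀] g) : Set.EqOn f g U := fun _ hz =>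
  (((hf hz).eventuallyEq_nhdsNE_iff_eventuallyEq_nhds (hg hz)).1
    (hf.meromorphicOn.eventuallyEq_nhdsNE_of_isPreconnected hg.meromorphicOn hU hz₀ hz h)).eq_of_nhds

lemma eventually_nhdsNE_of_lt_re {P : ℂ → Prop} {T : ℝ} (h : ∀ t : ℂ, T < t.re → P t) {z : ℂ}
    (hz : T < z.re) : ∀ᶠ t in 𝓝[≠] z, P t := by
  have : {t : ℂ | T < t.re} ∈ 𝓝 z :=
    (isOpen_lt continuous_const Complex.continuous_re).mem_nhds hz
  filter_upwards [mem_nhdsWithin_of_mem_nhds this] with t ht using h t ht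

theorem exists_isThetaContinuation {r s : ℂ} {x : ℝ} (hx : 0 < x) (hr : 1 ≤ r.re) :
    ∃ F, IsThetaContinuation r s x F := by
  -- a continuation to each half-plane `-M < Re t`, in normal form
  have hpiece : ∀ M : ℕ, ∃ f : ℂ → ℂ, MeromorphicNFOn f {t | -(M : ℝ) < t.re} ∧ ∃ T : ℝ,
      ∀ z : ℂ, T < z.re → f =ᶠ[𝓝[≠] z] thetaSum r s x := by
    intro M
    obtain ⟨K, hK⟩ := exists_thetaSum_eq (s := s) hx hr M
    obtain ⟨h, hh, T, hT⟩ := hK K le_rfl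
    have hmer := meromorphicOn_inv_Gamma_mul_polar_add
      (polylogExpansion r 1 K * polylogExpansion s x K)
      (isOpen_lt continuous_const Complex.continuous_re) hh
    refine ⟨toMeromorphicNFOn _ {t | -(M : ℝ) < t.re}, meromorphicNFOn_toMeromorphicNFOn
      (fun t => (Complex.Gamma t)⁻¹ *
        ((polylogExpansion r 1 K * polylogExpansion s x K).polar t + h t)) _, max T (-M),
      fun z hz => ?_⟩
    have hzM : -(M : ℝ) < z.re := (le_max_right _ _).trans_lt hz
    have hzT : T < z.re := (le_max_left _ _).trans_lt hz
    refine (hmer.toMeromorphicNFOn_eq_self_on_nhdsNE hzM).trans ?_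
    exact eventually_nhdsNE_of_lt_re (fun t ht => (hT t ht).2.symm) hzT
  choose f hf T hT using hpiece
  -- two pieces agree wherever both are defined
  have hagree : ∀ (M M' : ℕ) (t : ℂ), -(M : ℝ) < t.re → -(M' : ℝ) < t.re → f M t = f M' t := by
    intro M M' t h1 h2
    set z : ℂ := ((max (max (T M) (T M')) 0 + 1 : ℝ) : ℂ) with hz
    have hz0 : max (max (T M) (T M')) 0 < z.re := by simp [hz]
    have hzM : T M < z.re := ((le_max_left _ _).trans (le_max_left _ _)).trans_lt hz0
    have hzM' : T M' < z.re := ((le_max_right _ _).trans (le_max_left _ _)).trans_lt hz0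
    have hz0' : 0 < z.re := (le_max_right _ _).trans_lt hz0
    refine MeromorphicNFOn.eqOn_of_isPreconnected
      (U := {t : ℂ | -(M : ℝ) < t.re} ∩ {t | -(M' : ℝ) < t.re})
      (fun w hw => hf M hw.1) (fun w hw => hf M' hw.2)
      ((convex_halfSpace_re_gt _).inter (convex_halfSpace_re_gt _)).isPreconnected (z₀ := z) ?_
      ((hT M z hzM).trans (hT M' z hzM').symm) ⟨h1, h2⟩
    constructor
    · exact (neg_nonpos.2 M.cast_nonneg).trans_lt hz0'
    · exact (neg_nonpos.2 M'.cast_nonneg).trans_lt hz0'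
  -- the pieces extend the sum of the series
  have hregion : ∀ (M : ℕ) (t : ℂ), -(M : ℝ) < t.re → thetaRegion r s t →
      f M t = thetaSum r s x t := by
    intro M t h1 h2
    obtain ⟨T₀, hT₀⟩ : ∃ T₀ : ℝ, ∀ t, thetaRegion r s t ↔ T₀ < t.re := ⟨_, thetaRegion_iff r s⟩
    have hset : {t | thetaRegion r s t} = {t : ℂ | T₀ < t.re} := Set.ext hT₀
    set z : ℂ := ((max (max (T M) T₀) 0 + 1 : ℝ) : ℂ) with hz
    have hz0 : max (max (T M) T₀) 0 < z.re := by simp [hz]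
    have hzM : T M < z.re := ((le_max_left _ _).trans (le_max_left _ _)).trans_lt hz0
    have hzT₀ : T₀ < z.re := ((le_max_right _ _).trans (le_max_left _ _)).trans_lt hz0
    have hz0' : 0 < z.re := (le_max_right _ _).trans_lt hz0
    refine MeromorphicNFOn.eqOn_of_isPreconnected
      (U := {t : ℂ | -(M : ℝ) < t.re} ∩ {t | T₀ < t.re})
      (fun w hw => hf M hw.1) (fun w hw => ?_)
      ((convex_halfSpace_re_gt _).inter (convex_halfSpace_re_gt _)).isPreconnected (z₀ := z) ?_
      (hT M z hzM) ⟨h1, (hT₀ t).1 h2⟩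
    · exact ((differentiableOn_thetaSum hx hr).analyticAt
        ((isOpen_thetaRegion r s).mem_nhds ((hT₀ w).2 hw.2))).meromorphicNFAt
    · exact ⟨(neg_nonpos.2 M.cast_nonneg).trans_lt hz0', hzT₀⟩
  have hindex : ∀ t : ℂ, -((⌈|t.re|⌉₊ + 1 : ℕ) : ℝ) < t.re := by
    intro t
    have h1 := Nat.le_ceil |t.re|
    have h2 := neg_abs_le t.re
    push_cast
    linarith
  refine ⟨fun t => f (⌈|t.re|⌉₊ + 1) t, fun t _ => ?_, fun t ht => ?_⟩
  · refine (meromorphicNFAt_congr ?_).2 (hf _ (hindex t))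
    filter_upwards [(isOpen_lt continuous_const Complex.continuous_re).mem_nhds (hindex t)]
      with w hw
    exact hagree _ _ w (hindex w) hw
  · rw [hregion _ t (hindex t) ht]
    exact hasSum_thetaSum hx hr ht

lemma isThetaContinuation_Theta {r s : ℂ} {x : ℝ} (hx : 0 < x) (hr : 1 ≤ r.re) :
    IsThetaContinuation r s x (fun t => Theta r s t x) := by
  have h := exists_isThetaContinuation (s := s) hx hr
  have : (fun t => Theta r s t x) = h.choose := by
    funext t
    rw [Theta, dif_pos h]
  rw [this]
  exact h.choose_spec

theorem exists_Theta_eventuallyEq {r s : ℂ} {x : ℝ} (hx : 0 < x) (hr : 1 ≤ r.re) (t₀ : ℂ) :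
    ∃ K₀ : ℕ, ∀ K ≥ K₀, ∃ h : ℂ → ℂ, AnalyticAt ℂ h t₀ ∧ ∀ᶠ t in 𝓝[≠] t₀,
      Theta r s t x = (Complex.Gamma t)⁻¹ *
        ((polylogExpansion r 1 K * polylogExpansion s x K).polar t + h t) := by
  set M : ℝ := |t₀.re| + 1 with hM
  obtain ⟨K₀, hK₀⟩ := exists_thetaSum_eq (s := s) hx hr M
  refine ⟨K₀, fun K hK => ?_⟩
  obtain ⟨h, hh, T, hT⟩ := hK₀ K hK
  have hUo : IsOpen {t : ℂ | -M < t.re} := isOpen_lt continuous_const Complex.continuous_re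
  have ht₀ : -M < t₀.re := by linarith [neg_abs_le t₀.re]
  refine ⟨h, hh.analyticAt (hUo.mem_nhds ht₀), ?_⟩
  have hΘ := isThetaContinuation_Theta (s := s) hx hr
  set z : ℂ := ((max T (-M) + 1 : ℝ) : ℂ) with hz
  have hz0 : max T (-M) < z.re := by simp [hz]
  refine MeromorphicOn.eventuallyEq_nhdsNE_of_isPreconnected
    (f := fun t => Theta r s t x) (U := {t : ℂ | -M < t.re}) (z₀ := z)
    (fun t _ => (hΘ.meromorphic (Set.mem_univ t)).meromorphicAt)
    (meromorphicOn_inv_Gamma_mul_polar_add _ hUo hh) (convex_halfSpace_re_gt _).isPreconnected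
    ((le_max_right _ _).trans_lt hz0) ht₀ ?_
  refine eventually_nhdsNE_of_lt_re (fun t ht => ?_) ((le_max_left _ _).trans_lt hz0)
  obtain ⟨h1, h2⟩ := hT t ht
  refine Eq.trans ?_ h2
  exact (hΘ.hasSum t h1).unique (hasSum_thetaSum hx hr h1)

/-! ### The reciprocal Gamma function at its zeros -/

lemma AnalyticAt.sub_taylor_isBigO {f : ℂ → ℂ} {z : ℂ} (hf : AnalyticAt ℂ f z) (n : ℕ) :
    (fun y => f (z + y) - ∑ k ∈ range n, iteratedDeriv k f z / (k ! : ℂ) * y ^ k) =O[𝓝 0]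
      fun y => y ^ n := by
  have h := hf.hasFPowerSeriesAt.isBigO_sub_partialSum_pow n
  rw [← isBigO_norm_right]
  simp only [norm_pow]
  refine h.congr_left fun y => ?_
  simp [FormalMultilinearSeries.partialSum, mul_comm]

/-- This is `(log Γ)'' + ((log Γ)') ^ 2 = Γ'' / Γ`. -/
lemma iteratedDeriv_two_Gamma (N : ℕ) : iteratedDeriv 2 Complex.Gamma (N + 1) =
    (N ! : ℂ) * (deriv Complex.digamma (N + 1) + Complex.digamma (N + 1) ^ 2) := by
  have hU : IsOpen {z : ℂ | 0 < z.re} := isOpen_lt continuous_const Complex.continuous_re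
  have hN : ((N : ℂ) + 1) ∈ {z : ℂ | 0 < z.re} := by
    simp only [Set.mem_ofPred_eq, Complex.add_re, Complex.natCast_re, Complex.one_re]
    positivity
  have hne : ∀ z : ℂ, 0 < z.re → ∀ m : ℕ, z ≠ -m := by
    rintro z hz m rfl
    simp only [Complex.neg_re, Complex.natCast_re] at hz
    linarith [Nat.cast_nonneg (α := ℝ) m]
  have hG : ∀ z ∈ {z : ℂ | 0 < z.re}, AnalyticAt ℂ Complex.Gamma z := fun z hz => by
    have : DifferentiableOn ℂ Complex.Gamma {z : ℂ | 0 < z.re} := fun w hw =>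
      (Complex.differentiableAt_Gamma w (hne w hw)).differentiableWithinAt
    exact this.analyticAt (hU.mem_nhds hz)
  have hG0 : Complex.Gamma (N + 1) ≠ 0 := Complex.Gamma_ne_zero_of_re_pos hN
  have hψ : DifferentiableAt ℂ Complex.digamma (N + 1) := by
    have h1 : AnalyticAt ℂ (fun z => deriv Complex.Gamma z / Complex.Gamma z) (N + 1) :=
      (hG _ hN).deriv.div (hG _ hN) hG0
    exact h1.differentiableAt
  have h1 : deriv Complex.Gamma =ᶠ[𝓝 ((N : ℂ) + 1)]
      fun z => Complex.digamma z * Complex.Gamma z := by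
    filter_upwards [hU.mem_nhds hN] with z hz
    rw [Complex.digamma_def, logDeriv_apply, div_mul_cancel₀ _
      (Complex.Gamma_ne_zero_of_re_pos hz)]
  rw [iteratedDeriv_succ, iteratedDeriv_one, h1.deriv_eq,
    deriv_fun_mul hψ (hG _ hN).differentiableAt, h1.eq_of_nhds, Complex.Gamma_nat_eq_factorial]
  ring

lemma digamma_natCast_add_one (N : ℕ) :
    Complex.digamma (N + 1) = -(eulerGamma - harmonicC N) := by
  have h : (N ! : ℂ) ≠ 0 := by exact_mod_cast N.factorial_ne_zero
  rw [Complex.digamma_def, logDeriv_apply, Complex.deriv_Gamma_nat,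
    Complex.Gamma_nat_eq_factorial, mul_div_cancel_left₀ _ h, eulerGamma, harmonicC]
  ring

lemma isBigO_Gamma_sub (N : ℕ) :
    (fun ε : ℂ => Complex.Gamma (N + 1 - ε) - (N ! : ℂ) * (1 - Complex.digamma (N + 1) * ε +
      (deriv Complex.digamma (N + 1) + Complex.digamma (N + 1) ^ 2) / 2 * ε ^ 2)) =O[𝓝 0]
      fun ε => ε ^ 3 := by
  have hU : IsOpen {z : ℂ | 0 < z.re} := isOpen_lt continuous_const Complex.continuous_re
  have hN : ((N : ℂ) + 1) ∈ {z : ℂ | 0 < z.re} := by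
    simp only [Set.mem_ofPred_eq, Complex.add_re, Complex.natCast_re, Complex.one_re]
    positivity
  have hG : AnalyticAt ℂ Complex.Gamma (N + 1) := by
    have : DifferentiableOn ℂ Complex.Gamma {z : ℂ | 0 < z.re} := fun w hw =>
      (Complex.differentiableAt_Gamma w (by
        rintro m rfl
        simp only [Set.mem_ofPred_eq, Complex.neg_re, Complex.natCast_re] at hw
        linarith [Nat.cast_nonneg (α := ℝ) m])).differentiableWithinAt
    exact this.analyticAt (hU.mem_nhds hN)
  have h1 : Tendsto (fun ε : ℂ => -ε) (𝓝 0) (𝓝 0) := by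
    simpa using (continuous_neg (G := ℂ)).tendsto 0
  have h2 := (hG.sub_taylor_isBigO 3).comp_tendsto h1
  have h3 : ((fun y : ℂ => y ^ 3) ∘ fun ε => -ε) =O[𝓝 0] fun ε : ℂ => ε ^ 3 := by
    refine IsBigO.of_bound 1 (Eventually.of_forall fun ε => ?_)
    simp
  refine (h2.trans h3).congr_left fun ε => ?_
  have hd : deriv Complex.Gamma (N + 1) = (N ! : ℂ) * Complex.digamma (N + 1) := by
    rw [digamma_natCast_add_one, Complex.deriv_Gamma_nat, eulerGamma, harmonicC]
    ring
  simp only [Function.comp_apply, Finset.sum_range_succ, Finset.sum_range_zero,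
    iteratedDeriv_zero, iteratedDeriv_one, iteratedDeriv_two_Gamma, hd,
    Complex.Gamma_nat_eq_factorial, ← sub_eq_add_neg]
  simp [Nat.factorial]
  ring

lemma isBigO_sin_sub : (fun ε : ℂ => Complex.sin (Real.pi * ε) / Real.pi -
    (ε - (Real.pi : ℂ) ^ 2 / 6 * ε ^ 3)) =O[𝓝 0] fun ε => ε ^ 4 := by
  have h0 : AnalyticAt ℂ Complex.sin 0 := Complex.differentiable_sin.analyticAt 0
  have h1 : Tendsto (fun ε : ℂ => (Real.pi : ℂ) * ε) (𝓝 0) (𝓝 0) := by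
    simpa using (continuous_const_mul (Real.pi : ℂ)).tendsto 0
  have h2 := ((h0.sub_taylor_isBigO 4).comp_tendsto h1).const_mul_left (Real.pi : ℂ)⁻¹
  have h3 : ((fun y : ℂ => y ^ 4) ∘ fun ε => (Real.pi : ℂ) * ε) =O[𝓝 0] fun ε : ℂ => ε ^ 4 := by
    simp only [Function.comp_def, mul_pow]
    exact (isBigO_refl _ _).const_mul_left _
  refine (h2.trans h3).congr_left fun ε => ?_
  have hpi : (Real.pi : ℂ) ≠ 0 := by exact_mod_cast Real.pi_ne_zero
  simp only [Function.comp_apply, Finset.sum_range_succ, Finset.sum_range_zero,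
    iteratedDeriv_succ, iteratedDeriv_zero, Complex.deriv_sin, Complex.deriv_cos']
  simp [Nat.factorial]
  field_simp
  ring

lemma isBigO_pow_of_le {a b : ℕ} (h : a ≤ b) :
    (fun ε : ℂ => ε ^ b) =O[𝓝 0] fun ε => ε ^ a := by
  rw [← Nat.sub_add_cancel h]
  simp only [pow_add]
  have h1 : (fun ε : ℂ => ε ^ (b - a)) =O[𝓝 0] fun _ => (1 : ℂ) :=
    ((continuous_pow (b - a)).tendsto (0 : ℂ)).isBigO_one ℂ
  simpa using h1.mul (isBigO_refl (fun ε : ℂ => ε ^ a) (𝓝 0))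

/-- By the reflection formula, `1 / Γ(-N + ε) = (-1) ^ N * Γ(N + 1 - ε) * sin (π ε) / π`. -/
theorem isBigO_inv_Gamma_sub (N : ℕ) :
    (fun ε : ℂ => (Complex.Gamma (-N + ε))⁻¹ - (-1) ^ N * (N ! : ℂ) * (ε -
      Complex.digamma (N + 1) * ε ^ 2 + ((deriv Complex.digamma (N + 1) +
        Complex.digamma (N + 1) ^ 2) / 2 - (Real.pi : ℂ) ^ 2 / 6) * ε ^ 3)) =O[𝓝[≠] 0]
      fun ε => ε ^ 4 := by
  have hA := isBigO_Gamma_sub N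
  have hB := isBigO_sin_sub
  set ψ := Complex.digamma (N + 1)
  set e := (deriv Complex.digamma (N + 1) + ψ ^ 2) / 2
  have hpi : (Real.pi : ℂ) ≠ 0 := by exact_mod_cast Real.pi_ne_zero
  have hB1 : (fun ε : ℂ => Complex.sin (Real.pi * ε) / Real.pi) =O[𝓝 0] fun ε => ε ^ 1 := by
    have h1 : (fun ε : ℂ => ε - (Real.pi : ℂ) ^ 2 / 6 * ε ^ 3) =O[𝓝 0] fun ε => ε ^ 1 := by
      have := (isBigO_pow_of_le (show 1 ≤ 1 by norm_num)).sub
        ((isBigO_pow_of_le (show 1 ≤ 3 by norm_num)).const_mul_left ((Real.pi : ℂ) ^ 2 / 6))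
      simpa using this
    simpa using (hB.trans (isBigO_pow_of_le (by norm_num))).add h1
  have hP : (fun ε : ℂ => (N ! : ℂ) * (1 - ψ * ε + e * ε ^ 2)) =O[𝓝 0] fun _ => (1 : ℂ) := by
    have : Continuous fun ε : ℂ => (N ! : ℂ) * (1 - ψ * ε + e * ε ^ 2) := by fun_prop
    exact (this.tendsto 0).isBigO_one ℂ
  have h1 : (fun ε : ℂ => (Complex.Gamma (N + 1 - ε) - (N ! : ℂ) * (1 - ψ * ε + e * ε ^ 2)) *
      (Complex.sin (Real.pi * ε) / Real.pi)) =O[𝓝 0] fun ε => ε ^ 4 :=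
    (hA.mul hB1).congr_right fun ε => by ring
  have h2 : (fun ε : ℂ => (N ! : ℂ) * (1 - ψ * ε + e * ε ^ 2) *
      (Complex.sin (Real.pi * ε) / Real.pi - (ε - (Real.pi : ℂ) ^ 2 / 6 * ε ^ 3))) =O[𝓝 0]
      fun ε => ε ^ 4 :=
    (hP.mul hB).congr_right fun ε => by ring
  have h3 : (fun ε : ℂ => (N ! : ℂ) * (Real.pi : ℂ) ^ 2 / 6 * (ψ * ε ^ 4 - e * ε ^ 5)) =O[𝓝 0]
      fun ε => ε ^ 4 :=
    (((isBigO_refl _ _).const_mul_left _).sub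
      ((isBigO_pow_of_le (by norm_num)).const_mul_left _)).const_mul_left _
  have h4 := (((h1.add h2).add h3).const_mul_left ((-1 : ℂ) ^ N)).mono
    (nhdsWithin_le_nhds (s := {0}ᶜ))
  refine h4.congr' ?_ EventuallyEq.rfl
  have hsin : ∀ᶠ ε : ℂ in 𝓝[≠] 0, Complex.sin (Real.pi * ε) ≠ 0 := by
    have hd : HasDerivAt (fun ε : ℂ => Complex.sin (Real.pi * ε)) (Real.pi : ℂ) 0 := by
      have := (((hasDerivAt_id (0 : ℂ)).const_mul (Real.pi : ℂ))).csin
      simpa using this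
    have := hd.eventually_ne (c := 0) hpi
    simpa using this
  filter_upwards [hsin] with ε hε
  have hrefl := Complex.Gamma_mul_Gamma_one_sub (-N + ε)
  have hsinN : Complex.sin (Real.pi * (-N + ε)) = (-1) ^ N * Complex.sin (Real.pi * ε) := by
    have : (Real.pi : ℂ) * (-N + ε) = Real.pi * ε - N * Real.pi := by ring
    rw [this, Complex.sin_antiperiodic.sub_nat_mul_eq]
  rw [hsinN] at hrefl
  have hm1 : ((-1 : ℂ) ^ N) ≠ 0 := pow_ne_zero _ (by norm_num)
  have hsub : (1 : ℂ) - (-N + ε) = N + 1 - ε := by ring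
  rw [hsub] at hrefl
  have hinv : (Complex.Gamma (-N + ε))⁻¹ =
      (-1) ^ N * Complex.Gamma (N + 1 - ε) * (Complex.sin (Real.pi * ε) / Real.pi) := by
    refine inv_eq_of_mul_eq_one_right ?_
    calc Complex.Gamma (-N + ε) *
          ((-1) ^ N * Complex.Gamma (N + 1 - ε) * (Complex.sin (Real.pi * ε) / Real.pi))
        = (Complex.Gamma (-N + ε) * Complex.Gamma (N + 1 - ε)) *
          ((-1) ^ N * Complex.sin (Real.pi * ε)) / Real.pi := by ring
      _ = 1 := by rw [hrefl]; field_simp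
  rw [hinv]
  ring

/-- The Laurent expansion at `-N` of the product of `1 / Γ`, which has a simple zero there, with a
function that has a pole of order at most three. -/
theorem isBigO_sub_laurent {F h : ℂ → ℂ} {N : ℕ} {t₀ : ℂ} (ht₀ : t₀ = -N)
    (hh : AnalyticAt ℂ h t₀) {c₁ c₂ c₃ d₁ d₂ : ℂ} (hd₁ : d₁ = -Complex.digamma (N + 1))
    (hd₂ : d₂ = (deriv Complex.digamma (N + 1) + Complex.digamma (N + 1) ^ 2) / 2 -
      (Real.pi : ℂ) ^ 2 / 6)
    (hF : ∀ᶠ t in 𝓝[≠] t₀, F t = (Complex.Gamma t)⁻¹ *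
      (c₁ / (t - t₀) + c₂ / (t - t₀) ^ 2 + c₃ / (t - t₀) ^ 3 + h t)) :
    (fun t => F t - (-1) ^ N * (N ! : ℂ) * (c₃ / (t - t₀) ^ 2 + (c₂ + d₁ * c₃) / (t - t₀) +
      (c₁ + d₁ * c₂ + d₂ * c₃))) =O[𝓝[≠] t₀] fun t => t - t₀ := by
  have htend : Tendsto (fun t => t - t₀) (𝓝[≠] t₀) (𝓝[≠] 0) := by
    refine tendsto_nhdsWithin_iff.2 ⟨?_, ?_⟩
    · have : ContinuousAt (fun t : ℂ => t - t₀) t₀ := by fun_prop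
      have h1 := this.tendsto
      rw [sub_self] at h1
      exact h1.mono_left nhdsWithin_le_nhds
    · filter_upwards [self_mem_nhdsWithin] with t ht
      exact sub_ne_zero.2 ht
  have hε0 := htend.mono_right nhdsWithin_le_nhds
  have hR := (isBigO_inv_Gamma_sub N).comp_tendsto htend
  have hh1 : h =O[𝓝[≠] t₀] fun _ => (1 : ℂ) :=
    (hh.continuousAt.tendsto.mono_left nhdsWithin_le_nhds).isBigO_one ℂ
  have hpow : ∀ {a b : ℕ}, a ≤ b →
      (fun t => (t - t₀) ^ b) =O[𝓝[≠] t₀] fun t => (t - t₀) ^ a := fun hab =>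
    (isBigO_pow_of_le hab).comp_tendsto hε0
  set A : ℂ := (-1) ^ N * (N ! : ℂ)
  set R : ℂ → ℂ := fun t => (Complex.Gamma t)⁻¹ -
    A * ((t - t₀) + d₁ * (t - t₀) ^ 2 + d₂ * (t - t₀) ^ 3) with hRdef
  have hR' : R =O[𝓝[≠] t₀] fun t => (t - t₀) ^ 4 := by
    refine hR.congr_left fun t => ?_
    have hN : -(N : ℂ) + (t - t₀) = t := by rw [ht₀]; ring
    simp only [Function.comp_apply, hRdef, hd₁, hd₂, hN]
    ring
  have hlin : (fun t => t - t₀) =O[𝓝[≠] t₀] fun t => (t - t₀) ^ 1 := by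
    simpa using isBigO_refl (fun t => t - t₀) (𝓝[≠] t₀)
  have e1 : (fun t => A * ((t - t₀) + d₁ * (t - t₀) ^ 2 + d₂ * (t - t₀) ^ 3) * h t)
      =O[𝓝[≠] t₀] fun t => t - t₀ := by
    have h1 := ((hlin.add ((hpow (show 1 ≤ 2 by norm_num)).const_mul_left d₁)).add
      ((hpow (show 1 ≤ 3 by norm_num)).const_mul_left d₂)).const_mul_left A
    simpa using h1.mul hh1
  have e2 : (fun t => A * ((d₁ * c₁ + d₂ * c₂) * (t - t₀) + d₂ * c₁ * (t - t₀) ^ 2))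
      =O[𝓝[≠] t₀] fun t => t - t₀ := by
    have h1 := ((hlin.const_mul_left (d₁ * c₁ + d₂ * c₂)).add
      ((hpow (show 1 ≤ 2 by norm_num)).const_mul_left (d₂ * c₁))).const_mul_left A
    simpa using h1
  have e3 : (fun t => R t * (c₁ / (t - t₀) + c₂ / (t - t₀) ^ 2 + c₃ / (t - t₀) ^ 3 + h t))
      =O[𝓝[≠] t₀] fun t => t - t₀ := by
    have h1 : (fun t => c₁ * (t - t₀) ^ 2 + c₂ * (t - t₀) + c₃ + (t - t₀) ^ 3 * h t)
        =O[𝓝[≠] t₀] fun _ => (1 : ℂ) := by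
      have : ContinuousAt (fun t => c₁ * (t - t₀) ^ 2 + c₂ * (t - t₀) + c₃ + (t - t₀) ^ 3 * h t)
          t₀ := by
        have := hh.continuousAt
        fun_prop
      exact (this.tendsto.mono_left nhdsWithin_le_nhds).isBigO_one ℂ
    have h2 : (fun t => (t - t₀) ^ 4 * ((t - t₀) ^ 3)⁻¹) =O[𝓝[≠] t₀] fun t => t - t₀ := by
      refine (EventuallyEq.isBigO ?_)
      filter_upwards [self_mem_nhdsWithin] with t ht
      have : t - t₀ ≠ 0 := sub_ne_zero.2 ht
      field_simp
    have h3 := ((hR'.mul (isBigO_refl (fun t => ((t - t₀) ^ 3)⁻¹) (𝓝[≠] t₀))).trans h2).mul h1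
    simp only [mul_one] at h3
    refine h3.congr' ?_ EventuallyEq.rfl
    filter_upwards [self_mem_nhdsWithin] with t ht
    have : t - t₀ ≠ 0 := sub_ne_zero.2 ht
    field_simp
  refine ((e1.add e2).add e3).congr' ?_ EventuallyEq.rfl
  filter_upwards [hF, self_mem_nhdsWithin] with t hFt ht
  have hne : t - t₀ ≠ 0 := sub_ne_zero.2 ht
  have hG : (Complex.Gamma t)⁻¹ =
      R t + A * ((t - t₀) + d₁ * (t - t₀) ^ 2 + d₂ * (t - t₀) ^ 3) := by
    simp only [hRdef]; ring
  rw [hFt, hG]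
  field_simp
  ring

/-! ### Coefficients of products of expansions -/

namespace LogPowerSum

lemma coeff_single_mul_add (α : ℂ) (b : ℕ) (c : ℂ) (p : LogPowerSum) (z : ℂ) (β : ℕ) :
    ((AddMonoidAlgebra.single (α, b) c : LogPowerSum) * p).coeff (z, b + β) =
      c * p.coeff (z - α, β) := by
  refine AddMonoidAlgebra.coeff_single_mul_eq_mul_coeff _ fun m _ => ?_
  rw [Prod.ext_iff, Prod.ext_iff]
  simp [eq_sub_iff_add_eq, add_comm]

lemma coeff_single_mul_of_lt (α : ℂ) {b β : ℕ} (hb : β < b) (c : ℂ) (p : LogPowerSum) (z : ℂ) :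
    ((AddMonoidAlgebra.single (α, b) c : LogPowerSum) * p).coeff (z, β) = 0 := by
  refine AddMonoidAlgebra.coeff_single_mul_of_forall_add_ne c p fun d h => ?_
  have := congrArg Prod.snd h
  simp only [Prod.snd_add] at this
  omega

end LogPowerSum

/-- The coefficient of `u ^ k` in the regular part of the expansion of `Li_s(e^{-xu})`. -/
def polylogCoeff (s : ℂ) (x : ℝ) (k : ℕ) : ℂ :=
  zetaFinitePart (s - k) * (-(x : ℂ)) ^ k / (k ! : ℂ)

lemma coeff_polylogExpansion (s : ℂ) (x : ℝ) (K : ℕ) (z : ℂ) (β : ℕ) :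
    (polylogExpansion s x K).coeff (z, β) = (polylogSing s x).coeff (z, β) +
      if β = 0 then ∑ k ∈ range K, if (k : ℂ) = z then polylogCoeff s x k else 0 else 0 := by
  rw [polylogExpansion, AddMonoidAlgebra.coeff_add, Finsupp.add_apply,
    AddMonoidAlgebra.coeff_sum, Finsupp.finsetSum_apply]
  congr 1
  split_ifs with h
  · subst h
    refine Finset.sum_congr rfl fun k _ => ?_
    rw [AddMonoidAlgebra.coeff_single, Finsupp.single_apply]
    simp [polylogCoeff]
  · refine Finset.sum_eq_zero fun k _ => ?_
    rw [AddMonoidAlgebra.coeff_single, Finsupp.single_apply]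
    simp [Ne.symm h]

lemma coeff_polylogSing_natCast_add_one (m : ℕ) (x : ℝ) (z : ℂ) (β : ℕ) :
    (polylogSing (m + 1) x).coeff (z, β) = if (m : ℂ) = z then
      if β = 0 then (-(x : ℂ)) ^ m / (m ! : ℂ) * (harmonicC m - Real.log x)
      else if β = 1 then -((-(x : ℂ)) ^ m / (m ! : ℂ)) else 0 else 0 := by
  rw [polylogSing_natCast_add_one, AddMonoidAlgebra.coeff_add, Finsupp.add_apply,
    AddMonoidAlgebra.coeff_single, AddMonoidAlgebra.coeff_single, Finsupp.single_apply,
    Finsupp.single_apply]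
  rcases β with _ | _ | β
  · simp
  · simp
  · simp

lemma coeff_polylogSing_of_ne {s : ℂ} (hs : ∀ n : ℕ, s ≠ n + 1) (x : ℝ) (z : ℂ) (β : ℕ) :
    (polylogSing s x).coeff (z, β) =
      if s - 1 = z ∧ β = 0 then Complex.Gamma (1 - s) * (x : ℂ) ^ (s - 1) else 0 := by
  rw [polylogSing_of_ne hs, AddMonoidAlgebra.coeff_single, Finsupp.single_apply]
  simp [Prod.ext_iff, eq_comm]

lemma coeff_polylogSing_of_two_le (s : ℂ) (x : ℝ) (z : ℂ) {β : ℕ} (hβ : 2 ≤ β) :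
    (polylogSing s x).coeff (z, β) = 0 := by
  by_cases h : ∃ n : ℕ, s = n + 1
  · obtain ⟨n, rfl⟩ := h
    rw [coeff_polylogSing_natCast_add_one, if_neg (by omega : β ≠ 0), if_neg (by omega : β ≠ 1),
      ite_self]
  · push Not at h
    rw [coeff_polylogSing_of_ne h, if_neg (by omega)]

lemma coeff_polylogExpansion_of_two_le (s : ℂ) (x : ℝ) (K : ℕ) (z : ℂ) {β : ℕ} (hβ : 2 ≤ β) :
    (polylogExpansion s x K).coeff (z, β) = 0 := by
  rw [coeff_polylogExpansion, coeff_polylogSing_of_two_le s x z hβ, if_neg (by omega), add_zero]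

lemma snd_le_two_of_mem_support_mul (r s : ℂ) (x y : ℝ) (K : ℕ) :
    ∀ a ∈ (polylogExpansion r x K * polylogExpansion s y K).coeff.support, a.2 ≤ 2 := by
  classical
  intro a ha
  have hle : ∀ (s : ℂ) (x : ℝ), ∀ b ∈ (polylogExpansion s x K).coeff.support, b.2 ≤ 1 := by
    intro s x b hb
    by_contra h
    exact Finsupp.mem_support_iff.1 hb (coeff_polylogExpansion_of_two_le s x K b.1 (by omega))
  obtain ⟨b, hb, c, hc, rfl⟩ := Finset.mem_add.1 (AddMonoidAlgebra.support_coeff_mul_subset _ _ ha)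
  have h1 := hle _ _ b hb
  have h2 := hle _ _ c hc
  rw [Prod.snd_add]
  omega

/-- Multiplication by the expansion of `Li_{n+1}(e^{-u})`, on the coefficients of the powers
`0`, `1`, `2` of the logarithm. -/
lemma coeff_polylogExpansion_natCast_add_one_mul (n K : ℕ) (y : LogPowerSum) (z : ℂ) :
    ((polylogExpansion (n + 1) 1 K * y).coeff (z, 0) =
      (-1) ^ n / (n ! : ℂ) * harmonicC n * y.coeff (z - n, 0) +
        ∑ k ∈ range K, polylogCoeff (n + 1) 1 k * y.coeff (z - k, 0)) ∧
    ((polylogExpansion (n + 1) 1 K * y).coeff (z, 1) =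
      (-1) ^ n / (n ! : ℂ) * (harmonicC n * y.coeff (z - n, 1) - y.coeff (z - n, 0)) +
        ∑ k ∈ range K, polylogCoeff (n + 1) 1 k * y.coeff (z - k, 1)) ∧
    ((polylogExpansion (n + 1) 1 K * y).coeff (z, 2) =
      (-1) ^ n / (n ! : ℂ) * (harmonicC n * y.coeff (z - n, 2) - y.coeff (z - n, 1)) +
        ∑ k ∈ range K, polylogCoeff (n + 1) 1 k * y.coeff (z - k, 2)) := by
  have h0 : ∀ (α c : ℂ) (β : ℕ), ((AddMonoidAlgebra.single (α, 0) c : LogPowerSum) * y).coeff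
      (z, β) = c * y.coeff (z - α, β) := fun α c β => by
    simpa using LogPowerSum.coeff_single_mul_add α 0 c y z β
  have h1 : ∀ (α c : ℂ) (β : ℕ), ((AddMonoidAlgebra.single (α, 1) c : LogPowerSum) * y).coeff
      (z, β + 1) = c * y.coeff (z - α, β) := fun α c β => by
    simpa [add_comm] using LogPowerSum.coeff_single_mul_add α 1 c y z β
  have h2 : ∀ (α c : ℂ), ((AddMonoidAlgebra.single (α, 1) c : LogPowerSum) * y).coeff
      (z, 0) = 0 := fun α c => LogPowerSum.coeff_single_mul_of_lt α one_pos c y z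
  have h1' : ∀ (α c : ℂ), ((AddMonoidAlgebra.single (α, 1) c : LogPowerSum) * y).coeff
      (z, 1) = c * y.coeff (z - α, 0) := fun α c => h1 α c 0
  have h1'' : ∀ (α c : ℂ), ((AddMonoidAlgebra.single (α, 1) c : LogPowerSum) * y).coeff
      (z, 2) = c * y.coeff (z - α, 1) := fun α c => h1 α c 1
  refine ⟨?_, ?_, ?_⟩ <;>
  · rw [polylogExpansion, polylogSing_natCast_add_one, add_mul, add_mul, Finset.sum_mul,
      AddMonoidAlgebra.coeff_add, Finsupp.add_apply, AddMonoidAlgebra.coeff_add,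
      Finsupp.add_apply, AddMonoidAlgebra.coeff_sum, Finsupp.finsetSum_apply]
    simp only [h0, h1', h1'', h2, Complex.ofReal_one, Real.log_one, Complex.ofReal_zero]
    simp only [polylogCoeff, Complex.ofReal_one]
    ring

lemma sum_mul_sum_ite_natCast_eq {N K : ℕ} (hK : N < K) (a b : ℕ → ℂ) :
    ∑ k ∈ range K, a k * ∑ j ∈ range K, (if (j : ℂ) = (N : ℂ) - k then b j else 0) =
      ∑ k ∈ range (N + 1), a k * b (N - k) := by
  rw [← Finset.sum_subset (Finset.range_mono (show N + 1 ≤ K by omega))]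
  · refine Finset.sum_congr rfl fun k hk => ?_
    have hk' : k ≤ N := Nat.lt_succ_iff.1 (Finset.mem_range.1 hk)
    rw [← Nat.cast_sub hk']
    simp only [Nat.cast_inj]
    rw [Finset.sum_ite_eq' (range K) (N - k) b, if_pos (by simp; omega)]
  · intro k _ hk
    have hk' : N < k := by simpa using hk
    rw [Finset.sum_eq_zero, mul_zero]
    intro j _
    rw [if_neg]
    intro h
    have : j + k = N := by
      have h1 : (j : ℂ) + k = N := by rw [h]; ring
      exact_mod_cast h1
    omega

lemma sum_ite_natCast_eq {m K : ℕ} (hK : m < K) (b : ℕ → ℂ) :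
    ∑ j ∈ range K, (if (j : ℂ) = (m : ℂ) then b j else 0) = b m := by
  simp only [Nat.cast_inj]
  rw [Finset.sum_ite_eq' (range K) m b, if_pos (by simpa using hK)]

/-- The convolution of the regular parts is the binomial sum of zeta values. -/
lemma factorial_mul_sum_polylogCoeff (r s : ℂ) (x : ℝ) (N : ℕ) :
    (-1) ^ N * (N ! : ℂ) * ∑ k ∈ range (N + 1), polylogCoeff r 1 k * polylogCoeff s x (N - k) =
      ∑ k ∈ range (N + 1), (N.choose k : ℂ) * (x : ℂ) ^ (N - k) *
        zetaFinitePart (r - k) * zetaFinitePart (s - N + k) := by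
  rw [Finset.mul_sum]
  refine Finset.sum_congr rfl fun k hk => ?_
  have hk' : k ≤ N := Nat.lt_succ_iff.1 (Finset.mem_range.1 hk)
  have h1 : (N ! : ℂ) = (N.choose k : ℂ) * (k ! : ℂ) * ((N - k)! : ℂ) := by
    exact_mod_cast (Nat.choose_mul_factorial_mul_factorial hk').symm
  have h2 : ((-1 : ℂ)) ^ N * ((-1) ^ k * (-1) ^ (N - k)) = 1 := by
    rw [← pow_add, Nat.add_sub_cancel' hk', ← mul_pow]
    simp
  have h3 : s - ((N - k : ℕ) : ℂ) = s - N + k := by rw [Nat.cast_sub hk']; ring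
  have hk0 : (k ! : ℂ) ≠ 0 := by exact_mod_cast k.factorial_ne_zero
  have hN0 : ((N - k)! : ℂ) ≠ 0 := by exact_mod_cast (N - k).factorial_ne_zero
  simp only [polylogCoeff]
  rw [h3, h1, neg_pow (x : ℂ), Complex.ofReal_one]
  field_simp
  linear_combination ((N.choose k : ℂ) * zetaFinitePart (r - k) * zetaFinitePart (s - N + k) *
    (x : ℂ) ^ (N - k)) * h2

/-! ### Expansions of `Θ` at its poles -/

/-- The expansion of `Θ` at `t₀` in terms of the coefficients `C₀`, `C₁`, `C₂` of
`u ^ N * (log u) ^ j`, where `N = n + ℓ` and `j = 0, 1, 2`, in the product of the expansions of the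
two polylogarithms. -/
theorem exists_Theta_sub_isBigO (n ℓ : ℕ) (s : ℂ) {x : ℝ} (hx : 0 < x) {t₀ : ℂ}
    (ht₀ : t₀ = -((n + ℓ : ℕ) : ℂ)) :
    ∃ K₀ : ℕ, ∀ K ≥ K₀, ∀ C₀ C₁ C₂ : ℂ,
      (polylogExpansion (n + 1) 1 K * polylogExpansion s x K).coeff (((n + ℓ : ℕ) : ℂ), 0) = C₀ →
      (polylogExpansion (n + 1) 1 K * polylogExpansion s x K).coeff (((n + ℓ : ℕ) : ℂ), 1) = C₁ →
      (polylogExpansion (n + 1) 1 K * polylogExpansion s x K).coeff (((n + ℓ : ℕ) : ℂ), 2) = C₂ →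
      (fun t => Theta (n + 1) s t x - (-1) ^ (n + ℓ) * ((n + ℓ)! : ℂ) *
        (2 * C₂ / (t - t₀) ^ 2 +
          (-C₁ + (eulerGamma - harmonicC (n + ℓ)) * (2 * C₂)) / (t - t₀) +
          (C₀ + (eulerGamma - harmonicC (n + ℓ)) * (-C₁) +
            ((deriv Complex.digamma ((n + ℓ : ℕ) + 1) + (eulerGamma - harmonicC (n + ℓ)) ^ 2) / 2 -
              (Real.pi : ℂ) ^ 2 / 6) * (2 * C₂)))) =O[𝓝[≠] t₀] fun t => t - t₀ := by
  obtain ⟨K₀, hK₀⟩ := exists_Theta_eventuallyEq (r := (n : ℂ) + 1) (s := s) hx (by simp) t₀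
  refine ⟨K₀, fun K hK C₀ C₁ C₂ hC₀ hC₁ hC₂ => ?_⟩
  obtain ⟨h, hh, hΘ⟩ := hK₀ K hK
  set p := polylogExpansion ((n : ℂ) + 1) 1 K * polylogExpansion s x K with hp
  obtain ⟨g, hg, hpolar⟩ := p.exists_analyticAt_polar ((n + ℓ : ℕ) : ℂ)
    (snd_le_two_of_mem_support_mul _ _ _ _ _)
  rw [← ht₀] at hg
  refine isBigO_sub_laurent ht₀ (hg.add hh) (by rw [digamma_natCast_add_one, neg_neg])
    (by rw [digamma_natCast_add_one, neg_sq]) ?_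
  filter_upwards [hΘ] with t ht
  have htN : t + ((n + ℓ : ℕ) : ℂ) = t - t₀ := by rw [ht₀]; ring
  rw [ht, hpolar, htN, hC₀, hC₁, hC₂, Pi.add_apply]
  ring

lemma factorial_mul_polylogCoeff (n ℓ : ℕ) (s : ℂ) (x : ℝ) :
    (-1) ^ (n + ℓ) * ((n + ℓ)! : ℂ) * ((-1) ^ n / (n ! : ℂ) * polylogCoeff s x ℓ) =
      ((n + ℓ).choose ℓ : ℂ) * (x : ℂ) ^ ℓ * zetaFinitePart (s - ℓ) := by
  have h1 : ((n + ℓ)! : ℂ) = ((n + ℓ).choose ℓ : ℂ) * (ℓ ! : ℂ) * (n ! : ℂ) := by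
    have := (Nat.choose_mul_factorial_mul_factorial (Nat.le_add_left ℓ n)).symm
    rw [Nat.add_sub_cancel] at this
    exact_mod_cast this
  have h2 : ((-1 : ℂ)) ^ (n + ℓ) * ((-1) ^ n * (-1) ^ ℓ) = 1 := by
    rw [← pow_add, ← mul_pow]
    simp
  have hn0 : (n ! : ℂ) ≠ 0 := by exact_mod_cast n.factorial_ne_zero
  have hl0 : (ℓ ! : ℂ) ≠ 0 := by exact_mod_cast ℓ.factorial_ne_zero
  rw [polylogCoeff, h1, neg_pow (x : ℂ)]
  field_simp
  linear_combination (((n + ℓ).choose ℓ : ℂ) * (x : ℂ) ^ ℓ * zetaFinitePart (s - ℓ)) * h2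

lemma zetaFinitePart_of_ne {z : ℂ} (hz : z ≠ 1) : zetaFinitePart z = riemannZeta z := if_neg hz

lemma zetaFinitePart_one : zetaFinitePart 1 = 0 := if_pos rfl

/-- The terms where one of the zeta functions is at its pole are removed by the condition `P`. -/
lemma sum_zetaFinitePart_eq (n ℓ : ℕ) (s : ℂ) (x : ℝ) (P : ℕ → Prop) [DecidablePred P]
    (hP : ∀ k ≤ n + ℓ, P k ↔ k ≠ n ∧ s - ((n + ℓ : ℕ) : ℂ) + k ≠ 1) :
    ∑ k ∈ range (n + ℓ + 1), ((n + ℓ).choose k : ℂ) * (x : ℂ) ^ (n + ℓ - k) *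
        zetaFinitePart ((n : ℂ) + 1 - k) * zetaFinitePart (s - ((n + ℓ : ℕ) : ℂ) + k) =
      ∑ k ∈ range (n + 1 + ℓ) with P k, ((n + 1 + ℓ - 1).choose k : ℂ) *
        (x : ℂ) ^ (n + 1 + ℓ - 1 - k) * riemannZeta (((n + 1 : ℕ) : ℂ) - k) *
          riemannZeta (1 + k - ℓ - ((n + 1 : ℕ) : ℂ) + s) := by
  have h1 : n + 1 + ℓ = n + ℓ + 1 := by omega
  rw [h1, Nat.add_sub_cancel, Finset.sum_filter]
  refine Finset.sum_congr rfl fun k hk => ?_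
  have hk' : k ≤ n + ℓ := Nat.lt_succ_iff.1 (Finset.mem_range.1 hk)
  have h2 : (n : ℂ) + 1 - k = 1 ↔ k = n := by
    constructor
    · intro h
      have : (n : ℂ) = k := by linear_combination h
      exact (Nat.cast_injective this).symm
    · rintro rfl; ring
  split_ifs with h
  · obtain ⟨h3, h4⟩ := (hP k hk').1 h
    rw [zetaFinitePart_of_ne (fun h => h3 (h2.1 h)), zetaFinitePart_of_ne h4]
    congr 2
    · push_cast; ring
    · push_cast; ring
  · rw [hP k hk', not_and_or, not_not, not_not] at h
    rcases h with h | h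
    · rw [h2.2 h, zetaFinitePart_one]; ring
    · rw [h, zetaFinitePart_one]; ring

/-- When `s` is not a positive integer, the singular term `Γ(1 - s) (xu) ^ (s - 1)` of the second
factor contributes, at most, its product with one regular term of the first factor. -/
theorem Theta_sub_isBigO_of_ne (n ℓ : ℕ) {s : ℂ} (hs : ∀ m : ℕ, s ≠ m + 1) {x : ℝ} (hx : 0 < x)
    {t₀ : ℂ} (ht₀ : t₀ = -((n + ℓ : ℕ) : ℂ)) :
    ∃ K₀ : ℕ, ∀ K ≥ K₀,
      (fun t => Theta (n + 1) s t x -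
        (((n + ℓ).choose ℓ : ℂ) * (x : ℂ) ^ ℓ * (riemannZeta (s - ℓ) / (t - t₀)) +
        ((n + ℓ).choose ℓ : ℂ) * (x : ℂ) ^ ℓ * riemannZeta (s - ℓ) *
          (eulerGamma + harmonicC n - harmonicC (n + ℓ)) +
        (∑ k ∈ range (n + ℓ + 1), ((n + ℓ).choose k : ℂ) * (x : ℂ) ^ (n + ℓ - k) *
          zetaFinitePart ((n : ℂ) + 1 - k) * zetaFinitePart (s - ((n + ℓ : ℕ) : ℂ) + k)) +
        (-1) ^ (n + ℓ) * ((n + ℓ)! : ℂ) * (Complex.Gamma (1 - s) * (x : ℂ) ^ (s - 1) *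
          ∑ k ∈ range K, if s - 1 = ((n + ℓ : ℕ) : ℂ) - k then
            polylogCoeff (n + 1) 1 k else 0))) =O[𝓝[≠] t₀] fun t => t - t₀ := by
  obtain ⟨K₀, hK₀⟩ := exists_Theta_sub_isBigO n ℓ s hx ht₀
  refine ⟨max K₀ (n + ℓ + 1), fun K hK => ?_⟩
  have hKN : n + ℓ < K := (le_max_right _ _).trans hK
  have hKℓ : ℓ < K := by omega
  have hNn : ((n + ℓ : ℕ) : ℂ) - n = ℓ := by push_cast; ring
  have hsℓ : s - 1 ≠ ℓ := fun h => hs ℓ (by rw [← h]; ring)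
  have hζ : zetaFinitePart (s - ℓ) = riemannZeta (s - ℓ) :=
    zetaFinitePart_of_ne fun h => hsℓ (by linear_combination h)
  obtain ⟨e₀, e₁, e₂⟩ := coeff_polylogExpansion_natCast_add_one_mul n K (polylogExpansion s x K)
    ((n + ℓ : ℕ) : ℂ)
  have hy0 : ∀ z : ℂ, (polylogExpansion s x K).coeff (z, 0) =
      (if s - 1 = z then Complex.Gamma (1 - s) * (x : ℂ) ^ (s - 1) else 0) +
        ∑ k ∈ range K, if (k : ℂ) = z then polylogCoeff s x k else 0 := fun z => by
    rw [coeff_polylogExpansion, coeff_polylogSing_of_ne hs]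
    simp
  have hy1 : ∀ z : ℂ, (polylogExpansion s x K).coeff (z, 1) = 0 := fun z => by
    rw [coeff_polylogExpansion, coeff_polylogSing_of_ne hs]
    simp
  have hy2 : ∀ z : ℂ, (polylogExpansion s x K).coeff (z, 2) = 0 := fun z =>
    coeff_polylogExpansion_of_two_le s x K z le_rfl
  simp only [hNn, hy0, hy1, hy2, mul_zero, sub_zero, zero_sub, add_zero, if_neg hsℓ, zero_add,
    sum_ite_natCast_eq hKℓ, mul_add, Finset.sum_add_distrib, Finset.sum_const_zero,
    sum_mul_sum_ite_natCast_eq hKN, mul_ite] at e₀ e₁ e₂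
  refine (hK₀ K ((le_max_left _ _).trans hK) _ _ _ e₀ e₁ e₂).congr_left fun t => ?_
  have hb := factorial_mul_polylogCoeff n ℓ s x
  have hS := factorial_mul_sum_polylogCoeff ((n : ℂ) + 1) s x (n + ℓ)
  rw [hζ] at hb
  rw [← hS]
  have hE : ∑ k ∈ range K, (if s - 1 = ((n + ℓ : ℕ) : ℂ) - k then
      polylogCoeff (n + 1) 1 k * (Complex.Gamma (1 - s) * (x : ℂ) ^ (s - 1)) else 0) =
      Complex.Gamma (1 - s) * (x : ℂ) ^ (s - 1) *
        ∑ k ∈ range K, if s - 1 = ((n + ℓ : ℕ) : ℂ) - k then polylogCoeff (n + 1) 1 k else 0 := by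
    rw [Finset.mul_sum]
    refine Finset.sum_congr rfl fun k _ => ?_
    split_ifs <;> ring
  rw [hE]
  linear_combination (-(1 / (t - t₀)) - (eulerGamma + harmonicC n - harmonicC (n + ℓ))) * hb

/-- When `s = m + 1`, the term `(-xu) ^ m / m! * (H_m - log (xu))` of the second factor contributes
its products with a regular term of the first factor, whose coefficient is `A`, and with the
singular term of the first factor, which matters only for `m = ℓ` and is switched on by `δ`. -/
theorem Theta_sub_isBigO_natCast_add_one (n ℓ m : ℕ) {x : ℝ} (hx : 0 < x)
    {t₀ : ℂ} (ht₀ : t₀ = -((n + ℓ : ℕ) : ℂ)) (A δ Z : ℂ)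
    (hA : A = if m ≤ n + ℓ then polylogCoeff (n + 1) 1 (n + ℓ - m) else 0)
    (hδ : δ = if m = ℓ then 1 else 0) (hZ : Z = zetaFinitePart ((m : ℂ) + 1 - ℓ)) :
      (fun t => Theta (n + 1) (m + 1) t x -
        (((n + ℓ).choose ℓ : ℂ) * (x : ℂ) ^ ℓ * (Z / (t - t₀)) +
        ((n + ℓ).choose ℓ : ℂ) * (x : ℂ) ^ ℓ * Z *
          (eulerGamma + harmonicC n - harmonicC (n + ℓ)) +
        (∑ k ∈ range (n + ℓ + 1), ((n + ℓ).choose k : ℂ) * (x : ℂ) ^ (n + ℓ - k) *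
          zetaFinitePart ((n : ℂ) + 1 - k) *
            zetaFinitePart ((m : ℂ) + 1 - ((n + ℓ : ℕ) : ℂ) + k)) +
        (-1) ^ (n + ℓ) * ((n + ℓ)! : ℂ) * ((-(x : ℂ)) ^ m / (m ! : ℂ)) *
          (A / (t - t₀) + A *
            (eulerGamma + harmonicC m - harmonicC (n + ℓ) - Real.log x)) +
        δ * ((-1) ^ (n + ℓ) * ((n + ℓ)! : ℂ) * ((-(x : ℂ)) ^ m / (m ! : ℂ)) *
          ((-1) ^ n / (n ! : ℂ))) *
          (2 / (t - t₀) ^ 2 + (harmonicC n + harmonicC m - Real.log x +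
            2 * (eulerGamma - harmonicC (n + ℓ))) / (t - t₀) +
            (harmonicC n * (harmonicC m - Real.log x) + (eulerGamma - harmonicC (n + ℓ)) *
              (harmonicC n + harmonicC m - Real.log x) + (eulerGamma - harmonicC (n + ℓ)) ^ 2 +
              deriv Complex.digamma ((n + ℓ : ℕ) + 1) - (Real.pi : ℂ) ^ 2 / 3))))
        =O[𝓝[≠] t₀] fun t => t - t₀ := by
  obtain ⟨K₀, hK₀⟩ := exists_Theta_sub_isBigO n ℓ ((m : ℂ) + 1) hx ht₀
  set K := max K₀ (n + ℓ + 1) with hK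
  have hKN : n + ℓ < K := lt_of_lt_of_le (Nat.lt_succ_self _) (le_max_right _ _)
  have hKℓ : ℓ < K := by omega
  have hNn : ((n + ℓ : ℕ) : ℂ) - n = ℓ := by push_cast; ring
  obtain ⟨e₀, e₁, e₂⟩ := coeff_polylogExpansion_natCast_add_one_mul n K
    (polylogExpansion ((m : ℂ) + 1) x K) ((n + ℓ : ℕ) : ℂ)
  have hy0 : ∀ z : ℂ, (polylogExpansion ((m : ℂ) + 1) x K).coeff (z, 0) =
      (if (m : ℂ) = z then 1 else 0) *
        ((-(x : ℂ)) ^ m / (m ! : ℂ) * (harmonicC m - Real.log x)) +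
        ∑ k ∈ range K, if (k : ℂ) = z then polylogCoeff ((m : ℂ) + 1) x k else 0 := fun z => by
    rw [coeff_polylogExpansion, coeff_polylogSing_natCast_add_one]
    simp
  have hy1 : ∀ z : ℂ, (polylogExpansion ((m : ℂ) + 1) x K).coeff (z, 1) =
      (if (m : ℂ) = z then 1 else 0) * -((-(x : ℂ)) ^ m / (m ! : ℂ)) := fun z => by
    rw [coeff_polylogExpansion, coeff_polylogSing_natCast_add_one]
    by_cases h : (m : ℂ) = z <;> simp [h]
  have hy2 : ∀ z : ℂ, (polylogExpansion ((m : ℂ) + 1) x K).coeff (z, 2) = 0 := fun z =>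
    coeff_polylogExpansion_of_two_le _ x K z le_rfl
  -- the singular term of the second factor against the regular part of the first
  have hsumA : ∀ c : ℂ, ∑ k ∈ range K, polylogCoeff ((n : ℂ) + 1) 1 k *
      ((if (m : ℂ) = ((n + ℓ : ℕ) : ℂ) - k then 1 else 0) * c) = A * c := by
    intro c
    have h1 : ∀ k, polylogCoeff ((n : ℂ) + 1) 1 k *
        ((if (m : ℂ) = ((n + ℓ : ℕ) : ℂ) - k then 1 else 0) * c) =
        if k + m = n + ℓ then polylogCoeff ((n : ℂ) + 1) 1 k * c else 0 := by
      intro k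
      have : (m : ℂ) = ((n + ℓ : ℕ) : ℂ) - k ↔ k + m = n + ℓ := by
        rw [eq_sub_iff_add_eq, add_comm]
        norm_cast
      simp only [this]
      split_ifs <;> ring
    rw [Finset.sum_congr rfl fun k _ => h1 k]
    by_cases hm : m ≤ n + ℓ
    · rw [hA, if_pos hm, Finset.sum_eq_single (n + ℓ - m)]
      · rw [if_pos (by omega)]
      · intro k _ hk
        rw [if_neg (by omega)]
      · intro h
        exact absurd (Finset.mem_range.2 (by omega)) h
    · rw [hA, if_neg hm, zero_mul]
      refine Finset.sum_eq_zero fun k _ => ?_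
      rw [if_neg (by omega)]
  have hδ' : (if (m : ℂ) = (ℓ : ℂ) then (1 : ℂ) else 0) = δ := by
    rw [hδ]; simp only [Nat.cast_inj]
  simp only [hNn, hy0, hy1, hy2, mul_zero, zero_sub, hδ', sum_ite_natCast_eq hKℓ] at e₀ e₁ e₂
  simp only [mul_add (polylogCoeff _ _ _), Finset.sum_add_distrib, Finset.sum_const_zero, hsumA,
    sum_mul_sum_ite_natCast_eq hKN] at e₀ e₁ e₂
  refine (hK₀ K (le_max_left _ _) _ _ _ e₀ e₁ e₂).congr_left fun t => ?_
  have hb := factorial_mul_polylogCoeff n ℓ ((m : ℂ) + 1) x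
  rw [← hZ] at hb
  rw [← factorial_mul_sum_polylogCoeff ((n : ℂ) + 1) ((m : ℂ) + 1) x (n + ℓ)]
  linear_combination (-(1 / (t - t₀)) - (eulerGamma + harmonicC n - harmonicC (n + ℓ))) * hb

/-! ### The expansions in the four cases -/

lemma factorial_mul_pow_mul_polylogCoeff {n N m : ℕ} (hm : m ≤ N) (x : ℝ) :
    (-1) ^ N * (N ! : ℂ) * ((-(x : ℂ)) ^ m / (m ! : ℂ)) * polylogCoeff (n + 1) 1 (N - m) =
      (N.choose m : ℂ) * (x : ℂ) ^ m * zetaFinitePart ((n : ℂ) + 1 - N + m) := by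
  obtain ⟨j, rfl⟩ := Nat.exists_eq_add_of_le' hm
  have h := factorial_mul_polylogCoeff j m ((n : ℂ) + 1 - j + m) x
  rw [add_sub_cancel_right] at h
  have h1 : (n : ℂ) + 1 - ((j + m : ℕ) : ℂ) + m = n + 1 - j := by push_cast; ring
  rw [h1, ← h, Nat.add_sub_cancel, polylogCoeff, polylogCoeff, add_sub_cancel_right,
    Complex.ofReal_one]
  ring

lemma factorial_mul_Gamma_mul_polylogCoeff (n ℓ j : ℕ) (x : ℝ) :
    (-1) ^ (n + ℓ) * ((n + ℓ)! : ℂ) * (Complex.Gamma (1 - -(j : ℂ)) *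
      (x : ℂ) ^ (-(j : ℂ) - 1) * polylogCoeff (n + 1) 1 (n + 1 + ℓ + j)) =
    (-1) ^ (-(j : ℤ) - 1) * (((n + ℓ)! : ℂ) * (j ! : ℂ) / ((n + 1 + ℓ + j)! : ℂ)) *
      (x : ℂ) ^ (-(j : ℤ) - 1) * riemannZeta (-j - ℓ) := by
  have h1 : Complex.Gamma (1 - -(j : ℂ)) = (j ! : ℂ) := by
    rw [sub_neg_eq_add, add_comm, Complex.Gamma_nat_eq_factorial]
  have h2 : (x : ℂ) ^ (-(j : ℂ) - 1) = (x : ℂ) ^ (-(j : ℤ) - 1) := by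
    rw [← Complex.cpow_intCast]
    push_cast
    rfl
  have h3 : (n : ℂ) + 1 - ((n + 1 + ℓ + j : ℕ) : ℂ) = -j - ℓ := by push_cast; ring
  have h4 : (-(j : ℂ) - ℓ) ≠ 1 := by
    intro h
    have h5 := congrArg Complex.re h
    simp at h5
    have h6 : (0 : ℝ) ≤ j := j.cast_nonneg
    have h7 : (0 : ℝ) ≤ ℓ := ℓ.cast_nonneg
    linarith
  have h5 : ((-1 : ℂ)) ^ (-(j : ℤ) - 1) = (-1) ^ (j + 1) := by
    rw [show (-(j : ℤ) - 1) = -((j + 1 : ℕ) : ℤ) by push_cast; ring, zpow_neg, zpow_natCast,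
      ← inv_pow, inv_neg_one]
  have h6 : ((-1 : ℂ)) ^ (n + ℓ) * (-1) ^ (n + 1 + ℓ + j) = (-1) ^ (j + 1) := by
    rw [← pow_add, show n + ℓ + (n + 1 + ℓ + j) = 2 * (n + ℓ) + (j + 1) by ring, pow_add, pow_mul]
    simp
  rw [h1, h2, h5, ← h6, polylogCoeff, h3, zetaFinitePart_of_ne h4, Complex.ofReal_one]
  ring

end

theorem theorem2p4 (r : ℕ) (hr : 1 ≤ r) (ℓ : ℕ) (x : ℝ) (hx : 0 < x) :
    -- for each complex `s`, the meromorphic continuation in `t` exists and `Theta` is it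
    (∀ s : ℂ, IsThetaContinuation r s x (fun t => Theta r s t x)) ∧
    -- Case I
    (∀ s : ℂ, ((∃ n : ℤ, s = n ∧ (r : ℤ) + ℓ < n) ∨ ∀ n : ℤ, s ≠ n) →
      (fun t : ℂ => Theta r s t x -
        (((r + ℓ - 1).choose ℓ : ℂ) * (x : ℂ) ^ ℓ *
            (riemannZeta (s - ℓ) / (t - (1 - r - ℓ)))
          + ((r + ℓ - 1).choose ℓ : ℂ) * (x : ℂ) ^ ℓ * riemannZeta (s - ℓ) *
            (eulerGamma + harmonicC (r - 1) - harmonicC (r + ℓ - 1))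
          + ∑ k ∈ range (r + ℓ) with k ≠ r - 1,
              ((r + ℓ - 1).choose k : ℂ) * (x : ℂ) ^ (r + ℓ - 1 - k) *
                riemannZeta ((r : ℂ) - k) * riemannZeta (1 + k - ℓ - r + s)))
        =O[𝓝[≠] (1 - r - ℓ : ℂ)] (fun t : ℂ => t - (1 - r - ℓ))) ∧
    -- Case II, with `s = -j` for a natural number `j`
    (∀ j : ℕ,
      (fun t : ℂ => Theta r (-j) t x -
        (((r + ℓ - 1).choose ℓ : ℂ) * (x : ℂ) ^ ℓ *
            (riemannZeta (-j - ℓ) / (t - (1 - r - ℓ)))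
          + ((r + ℓ - 1).choose ℓ : ℂ) * (x : ℂ) ^ ℓ * riemannZeta (-j - ℓ) *
            (eulerGamma + harmonicC (r - 1) - harmonicC (r + ℓ - 1))
          + (∑ k ∈ range (r + ℓ) with k ≠ r - 1,
              ((r + ℓ - 1).choose k : ℂ) * (x : ℂ) ^ (r + ℓ - 1 - k) *
                riemannZeta ((r : ℂ) - k) * riemannZeta (1 + k - ℓ - r + (-j)))
          + (-1) ^ (-(j : ℤ) - 1) * (((r + ℓ - 1)! : ℂ) * (j ! : ℂ) / ((r + ℓ + j)! : ℂ)) *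
              (x : ℂ) ^ (-(j : ℤ) - 1) * riemannZeta (-j - ℓ)))
        =O[𝓝[≠] (1 - r - ℓ : ℂ)] (fun t : ℂ => t - (1 - r - ℓ))) ∧
    -- Case III
    (∀ s : ℕ, 1 ≤ s → s ≤ r + ℓ → s ≠ ℓ + 1 →
      (fun t : ℂ => Theta r s t x -
        (((r + ℓ - 1).choose ℓ : ℂ) * (x : ℂ) ^ ℓ *
            (riemannZeta ((s : ℂ) - ℓ) / (t - (1 - r - ℓ)))
          + ((r + ℓ - 1).choose ℓ : ℂ) * (x : ℂ) ^ ℓ * riemannZeta ((s : ℂ) - ℓ) *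
            (eulerGamma + harmonicC (r - 1) - harmonicC (r + ℓ - 1))
          + ((r + ℓ - 1).choose (s - 1) : ℂ) * (x : ℂ) ^ (s - 1) *
            (riemannZeta ((s : ℂ) - ℓ) / (t - (1 - r - ℓ)))
          + ((r + ℓ - 1).choose (s - 1) : ℂ) * (x : ℂ) ^ (s - 1) * riemannZeta ((s : ℂ) - ℓ) *
            (eulerGamma + harmonicC (s - 1) - harmonicC (r + ℓ - 1) - (Real.log x : ℂ))
          + ∑ k ∈ range (r + ℓ) with k ≠ r - 1 ∧ k ≠ r + ℓ - s,
              ((r + ℓ - 1).choose k : ℂ) * (x : ℂ) ^ (r + ℓ - 1 - k) *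
                riemannZeta ((r : ℂ) - k) * riemannZeta (1 + k - ℓ - r + s)))
        =O[𝓝[≠] (1 - r - ℓ : ℂ)] (fun t : ℂ => t - (1 - r - ℓ))) ∧
    -- Case IV, `s = ℓ + 1`
    ((fun t : ℂ => Theta r (ℓ + 1) t x -
        (((r + ℓ - 1).choose ℓ : ℂ) * (2 * (x : ℂ) ^ ℓ / (t - (1 - r - ℓ)) ^ 2)
          + ((r + ℓ - 1).choose ℓ : ℂ) * ((x : ℂ) ^ ℓ *
              (2 * eulerGamma + harmonicC ℓ + harmonicC (r - 1) - 2 * harmonicC (r + ℓ - 1)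
                - (Real.log x : ℂ)) / (t - (1 - r - ℓ)))
          + 1 / 3 * ((r + ℓ - 1).choose ℓ : ℂ) * (x : ℂ) ^ ℓ *
              (-(Real.pi : ℂ) ^ 2
                + 3 * (eulerGamma + harmonicC ℓ - harmonicC (r + ℓ - 1) - (Real.log x : ℂ)) *
                    (eulerGamma + harmonicC (r - 1) - harmonicC (r + ℓ - 1))
                + 3 * deriv Complex.digamma (r + ℓ))
          + ∑ k ∈ range (r + ℓ) with k ≠ r - 1,
              ((r + ℓ - 1).choose k : ℂ) * (x : ℂ) ^ (r + ℓ - 1 - k) *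
                riemannZeta ((r : ℂ) - k) * riemannZeta (k - r + 2)))
        =O[𝓝[≠] (1 - r - ℓ : ℂ)] (fun t : ℂ => t - (1 - r - ℓ))) := by
  obtain ⟨n, rfl⟩ : ∃ n, r = n + 1 := ⟨r - 1, by omega⟩
  have ht₀ : (1 - ((n + 1 : ℕ) : ℂ) - ℓ : ℂ) = -((n + ℓ : ℕ) : ℂ) := by push_cast; ring
  have hr' : ((n + 1 : ℕ) : ℂ) = n + 1 := by push_cast; rfl
  have hN : n + 1 + ℓ - 1 = n + ℓ := by omega
  have hn : n + 1 - 1 = n := rfl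
  refine ⟨fun s => isThetaContinuation_Theta hx (by simp), ?_, ?_, ?_, ?_⟩
  -- `s` above `r + ℓ`, or not an integer
  · rintro s (⟨z, rfl, hz⟩ | hs)
    · obtain ⟨m, rfl⟩ : ∃ m : ℕ, z = m + 1 := ⟨(z - 1).toNat, by omega⟩
      have hm : n + ℓ < m := by omega
      have hs : (((m : ℤ) + 1 : ℤ) : ℂ) = m + 1 := by push_cast; rfl
      have hne : (m : ℂ) + 1 - ℓ ≠ 1 := by
        intro h
        have : (m : ℂ) = ℓ := by linear_combination h
        have := Nat.cast_injective this
        omega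
      have := Theta_sub_isBigO_natCast_add_one n ℓ m hx ht₀ 0 0 _
        (by rw [if_neg (by omega)]) (by rw [if_neg (by omega)]) rfl
      rw [hs]
      refine this.congr_left fun t => ?_
      rw [zetaFinitePart_of_ne hne, sum_zetaFinitePart_eq n ℓ _ x (fun k => k ≠ n + 1 - 1), hN, hn,
        hr']
      · ring
      · intro k hk
        have : (m : ℂ) + 1 - ((n + ℓ : ℕ) : ℂ) + k ≠ 1 := by
          intro h
          have h1 : ((m + k : ℕ) : ℂ) = ((n + ℓ : ℕ) : ℂ) := by
            push_cast at h ⊢; linear_combination h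
          have := Nat.cast_injective h1
          omega
        exact (and_iff_left this).symm
    · obtain ⟨K, hK⟩ := Theta_sub_isBigO_of_ne n ℓ (s := s)
        (fun m h => hs (m + 1) (by rw [h]; push_cast; rfl)) hx ht₀
      refine (hK K le_rfl).congr_left fun t => ?_
      have hE : ∑ k ∈ range K, (if s - 1 = ((n + ℓ : ℕ) : ℂ) - k then
          polylogCoeff (n + 1) 1 k else 0) = 0 :=
        Finset.sum_eq_zero fun k _ => if_neg fun h => hs (n + ℓ + 1 - k) (by
          push_cast at h ⊢; linear_combination h)
      rw [hE, sum_zetaFinitePart_eq n ℓ _ x (fun k => k ≠ n + 1 - 1), hN, hn, hr']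
      · ring
      · intro k hk
        have : s - ((n + ℓ : ℕ) : ℂ) + k ≠ 1 := fun h =>
          hs (n + ℓ + 1 - k) (by push_cast at h ⊢; linear_combination h)
        exact (and_iff_left this).symm
  -- `s = -j`: the term `k = r + ℓ + j` of the first factor meets `u ^ (s - 1)`
  · intro j
    have hs : ∀ m : ℕ, (-(j : ℂ)) ≠ m + 1 := by
      intro m h
      have : ((j + m + 1 : ℕ) : ℂ) = 0 := by push_cast; linear_combination -h
      exact absurd (Nat.cast_eq_zero.1 this) (by omega)
    obtain ⟨K, hK⟩ := Theta_sub_isBigO_of_ne n ℓ hs hx ht₀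
    have hmem := Finset.mem_range.2
      (lt_of_lt_of_le (Nat.lt_succ_self (n + 1 + ℓ + j)) (le_max_right K (n + 1 + ℓ + j + 1)))
    refine (hK _ (le_max_left K (n + 1 + ℓ + j + 1))).congr_left fun t => ?_
    rw [Finset.sum_eq_single_of_mem _ hmem fun k _ hk => if_neg fun h => hk (Nat.cast_injective
        (R := ℂ) (by push_cast at h ⊢; linear_combination h)),
      if_pos (by push_cast; ring), factorial_mul_Gamma_mul_polylogCoeff,
      sum_zetaFinitePart_eq n ℓ _ x (fun k => k ≠ n + 1 - 1), hN, hn, hr']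
    · intro k hk
      have : -(j : ℂ) - ((n + ℓ : ℕ) : ℂ) + k ≠ 1 := by
        intro h
        have h1 : ((k : ℕ) : ℂ) = ((n + 1 + ℓ + j : ℕ) : ℂ) := by
          push_cast at h ⊢; linear_combination h
        have := Nat.cast_injective h1
        omega
      exact (and_iff_left this).symm
  -- `s = m + 1` with `m ≤ N` and `m ≠ ℓ`
  · intro s hs1 hs2 hs3
    obtain ⟨m, rfl⟩ : ∃ m, s = m + 1 := ⟨s - 1, by omega⟩
    have hm : m ≤ n + ℓ := by omega
    have hs : ((m + 1 : ℕ) : ℂ) = m + 1 := by push_cast; rfl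
    have hne : (m : ℂ) + 1 - ℓ ≠ 1 := by
      intro h
      have : (m : ℂ) = ℓ := by linear_combination h
      have := Nat.cast_injective this
      omega
    have := Theta_sub_isBigO_natCast_add_one n ℓ m hx ht₀ _ 0 _ (if_pos hm).symm
      (by rw [if_neg (by omega)]) rfl
    refine this.congr_left fun t => ?_
    have hA := factorial_mul_pow_mul_polylogCoeff (n := n) hm x
    rw [show (n : ℂ) + 1 - ((n + ℓ : ℕ) : ℂ) + m = m + 1 - ℓ by push_cast; ring,
      zetaFinitePart_of_ne hne] at hA
    rw [zetaFinitePart_of_ne hne,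
      sum_zetaFinitePart_eq n ℓ _ x (fun k => k ≠ n + 1 - 1 ∧ k ≠ n + 1 + ℓ - (m + 1)), hN, hn,
      hr', hs, Nat.add_sub_cancel]
    · linear_combination (-(1 / (t - (1 - ((n : ℂ) + 1) - ℓ))) -
        (eulerGamma + harmonicC m - harmonicC (n + ℓ) - Real.log x)) * hA
    · intro k hk
      have : (m : ℂ) + 1 - ((n + ℓ : ℕ) : ℂ) + k ≠ 1 ↔ k ≠ n + 1 + ℓ - (m + 1) := by
        refine not_congr ⟨fun h => ?_, fun h => ?_⟩
        · have h1 : ((m + k : ℕ) : ℂ) = ((n + ℓ : ℕ) : ℂ) := by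
            push_cast at h ⊢; linear_combination h
          have := Nat.cast_injective h1
          omega
        · have h1 : ((m + k : ℕ) : ℂ) = ((n + ℓ : ℕ) : ℂ) := by
            congr 1; omega
          push_cast at h1 ⊢; linear_combination h1
      rw [this, hn]
  -- `s = ℓ + 1`: the regular terms at the poles of zeta vanish and the singular terms meet
  · have hA : (0 : ℂ) = if ℓ ≤ n + ℓ then polylogCoeff ((n : ℂ) + 1) 1 (n + ℓ - ℓ) else 0 := by
      rw [if_pos (Nat.le_add_left _ _), Nat.add_sub_cancel, polylogCoeff, add_sub_cancel_left,
        zetaFinitePart_one]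
      simp
    have hZ : (0 : ℂ) = zetaFinitePart ((ℓ : ℂ) + 1 - ℓ) := by
      rw [add_sub_cancel_left, zetaFinitePart_one]
    have := Theta_sub_isBigO_natCast_add_one n ℓ ℓ hx ht₀ 0 1 0 hA (if_pos rfl).symm hZ
    refine this.congr_left fun t => ?_
    have hb : (-1) ^ (n + ℓ) * ((n + ℓ)! : ℂ) * ((-(x : ℂ)) ^ ℓ / (ℓ ! : ℂ)) *
        ((-1) ^ n / (n ! : ℂ)) = ((n + ℓ).choose ℓ : ℂ) * (x : ℂ) ^ ℓ := by
      have h1 : ((n + ℓ)! : ℂ) = ((n + ℓ).choose ℓ : ℂ) * (ℓ ! : ℂ) * (n ! : ℂ) := by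
        have := (Nat.choose_mul_factorial_mul_factorial (Nat.le_add_left ℓ n)).symm
        rw [Nat.add_sub_cancel] at this
        exact_mod_cast this
      have h2 : ((-1 : ℂ)) ^ (n + ℓ) * ((-1) ^ n * (-1) ^ ℓ) = 1 := by
        rw [← pow_add, ← mul_pow]
        simp
      have hn0 : (n ! : ℂ) ≠ 0 := by exact_mod_cast n.factorial_ne_zero
      have hl0 : (ℓ ! : ℂ) ≠ 0 := by exact_mod_cast ℓ.factorial_ne_zero
      rw [h1, neg_pow (x : ℂ)]
      field_simp
      linear_combination (((n + ℓ).choose ℓ : ℂ) * (x : ℂ) ^ ℓ) * h2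
    rw [hb, sum_zetaFinitePart_eq n ℓ _ x (fun k => k ≠ n + 1 - 1), hN, hn, hr']
    · have h1 : ∀ k : ℕ, (1 + (k : ℂ) - ℓ - (n + 1) + (ℓ + 1)) = k - (n + 1) + 2 := fun k => by ring
      have h2 : (((n + ℓ : ℕ) : ℂ) + 1) = n + 1 + ℓ := by push_cast; ring
      simp only [h1, h2]
      ring
    · intro k hk
      have : (ℓ : ℂ) + 1 - ((n + ℓ : ℕ) : ℂ) + k ≠ 1 ↔ k ≠ n := by
        refine not_congr ⟨fun h => ?_, fun h => ?_⟩
        · have h1 : (k : ℂ) = n := by push_cast at h; linear_combination h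
          exact Nat.cast_injective h1
        · subst h; push_cast; ring
      rw [this, hn, and_self]
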